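/- Let $M(v)=(2\pi)^{-3/2}e^{-|v|^2/2}$ on $\mathbb R^3$. On the complex Hilbert space $L^2(\mathbb R^3_v)$ with $(f,g)=\int f\bar g\,dv$ put $Lf=\Delta_v f-\frac{|v|^2}{4}f+\frac32 f$ (with domain $\{f\in L^2: Lf\in L^2\}$), $P_0f=(f,\sqrt M)\sqrt M$, $P_1=I-P_0$, and for $\xi\in\mathbb R^3\setminus\{0\}$, $\varepsilon>0$ put $$B_\varepsilon(\xi)=L-i\varepsilon\, v\cdot\xi-i\varepsilon\,\frac{v\cdot\xi}{|\xi|^2}P_0,\qquad (f,g)_\xi=(f,g)+\frac1{|\xi|^2}(P_0f,P_0g).$$ Then there are constants $r_0>0$ and $C>0$, a function $\lambda_0=\lambda_0(s,\varepsilon)$ with complex values, and functions $\psi_0(\xi,\varepsilon)\in L^2(\mathbb R^3_v)$ such that the following holds. (1) $\lambda_0$ is $C^\infty$ in $(s,\varepsilon)$ on $\{(s,\varepsilon)\in\mathbb R^2: |\varepsilon|(1+|s|)\le r_0\}$ and satisfies there $$\big|\lambda_0(s,\varepsilon)+\varepsilon^2(1+s^2)\big|\le C\varepsilon^4(1+s^2)^2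 .$$ For all $\xi\ne0$ and $\varepsilon>0$ with $\varepsilon(1+|\xi|)\le r_0$, $$\sigma(B_\varepsilon(\xi))\cap\{\lambda\in\mathbb C:\ \mathrm{Re}\,\lambda>-\tfrac12\}=\{\lambda_0(|\xi|,\varepsilon)\}.$$ (2) For all such $\xi,\varepsilon$, $\lambda_0(|\xi|,\varepsilon)$ is an eigenvalue of $B_\varepsilon(\xi)$ whose eigenspace is spanned by the eigenfunction $\psi_0=\psi_0(\xi,\varepsilon)$. This eigenfunction is normalized by $(\psi_0,\overline{\psi_0})_\xi=1$, and $$\Big\|P_0\psi_0-\frac{|\xi|}{\sqrt{1+|\xi|^2}}\sqrt M\Big\|_{L^2}\le C\varepsilon|\xi|,\qquad \Big\|P_1\psi_0+i\varepsilon\sqrt{1+|\xi|^2}\,\Big(v\cdot\frac{\xi}{|\xi|}\Big)\sqrt M\Big\|_{L^2}\le C\varepsilon^2(1+|\xi|^2).$$ -/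

import Mathlib

open MeasureTheory
open scoped ContDiff SchwartzMap InnerProductSpace Laplacian ENNReal

namespace VPFP

noncomputable section

/-- The velocity space `ℝ³` with its Euclidean structure (also the space of frequencies `ξ`). -/
abbrev V3 : Type := EuclideanSpace ℝ (Fin 3)

/-- The complex Hilbert space `L²(ℝ³)`. Mathlib's inner product is conjugate linear in its first
argument, so that `(f, g) = ∫ f \bar g dv` is `inner ℂ g f`. -/
abbrev L2 : Type := Lp ℂ 2 (volume : Measure V3)

/-! ### Resolvent set and spectrum of an unbounded operator -/

/-- `z` is in the resolvent set of the (unbounded) operator `T` iff `z - T : D(T) → E` is bijective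
with a bounded inverse `R`. Replacing the norm of `E` by an equivalent one does not change it. -/
def resolventSet {E : Type*} [NormedAddCommGroup E] [NormedSpace ℂ E] (T : E →ₗ.[ℂ] E) : Set ℂ :=
  {z | ∃ R : E →L[ℂ] E,
    (∀ g : E, ∃ h : R g ∈ T.domain, z • R g - T ⟨R g, h⟩ = g) ∧
    (∀ f : T.domain, R (z • (f : E) - T f) = f)}

/-- The spectrum of an unbounded operator. -/
def spectrum {E : Type*} [NormedAddCommGroup E] [NormedSpace ℂ E] (T : E →ₗ.[ℂ] E) : Set ℂ :=
  (resolventSet T)ᶜ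

/-! ### The Maxwellian -/

/-- `M(v) = (2π)^{-3/2} exp(-|v|²/2)`. -/
def maxwellian (v : V3) : ℝ := (2 * Real.pi) ^ (-(3 / 2) : ℝ) * Real.exp (-‖v‖ ^ 2 / 2)

/-- `√M` as a complex-valued function. -/
def sqrtMFun (v : V3) : ℂ := ((Real.sqrt (maxwellian v) : ℝ) : ℂ)

lemma maxwellian_nonneg (v : V3) : 0 ≤ maxwellian v := by
  unfold maxwellian; positivity

lemma continuous_maxwellian : Continuous maxwellian := by
  unfold maxwellian; fun_prop

lemma continuous_sqrtMFun : Continuous sqrtMFun :=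
  Complex.continuous_ofReal.comp (Real.continuous_sqrt.comp continuous_maxwellian)

lemma norm_sqrtMFun_sq (v : V3) : ‖sqrtMFun v‖ ^ 2 = maxwellian v := by
  rw [sqrtMFun, Complex.norm_real, Real.norm_eq_abs, sq_abs, Real.sq_sqrt (maxwellian_nonneg v)]

lemma integrable_gauss {b : ℝ} (hb : 0 < b) :
    Integrable (fun v : V3 => Real.exp (-b * ‖v‖ ^ 2)) := by
  have h := (GaussianFourier.integrable_cexp_neg_mul_sq_norm_add (V := V3) (b := (b : ℂ))
    (by simpa using hb) 0 0).norm
  refine h.congr (Filter.Eventually.of_forall fun v => ?_)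
  simp only [Complex.norm_exp]
  congr 1
  simp [← Complex.ofReal_pow]

lemma memLp_sqrtMFun : MemLp sqrtMFun 2 (volume : Measure V3) := by
  refine (memLp_two_iff_integrable_sq_norm continuous_sqrtMFun.aestronglyMeasurable).2 ?_
  simp only [norm_sqrtMFun_sq]
  have h := (integrable_gauss (b := 1 / 2) (by norm_num)).const_mul ((2 * Real.pi) ^ (-(3 / 2) : ℝ))
  refine h.congr (Filter.Eventually.of_forall fun v => ?_)
  simp only [maxwellian]
  congr 2
  ring

lemma memLp_mul_sqrtMFun (ξ : V3) :
    MemLp (fun v => ((inner ℝ v ξ : ℝ) : ℂ) * sqrtMFun v) 2 (volume : Measure V3) := by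
  have hc : Continuous (fun v : V3 => ((inner ℝ v ξ : ℝ) : ℂ) * sqrtMFun v) :=
    (Complex.continuous_ofReal.comp (by fun_prop)).mul continuous_sqrtMFun
  refine (memLp_two_iff_integrable_sq_norm hc.aestronglyMeasurable).2 ?_
  have h := (integrable_gauss (b := 1 / 4) (by norm_num)).const_mul
    (4 * ‖ξ‖ ^ 2 * (2 * Real.pi) ^ (-(3 / 2) : ℝ))
  refine h.mono' (hc.norm.pow 2).aestronglyMeasurable (Filter.Eventually.of_forall fun v => ?_)
  rw [Real.norm_of_nonneg (by positivity), norm_mul, mul_pow, norm_sqrtMFun_sq, Complex.norm_real]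
  have h1 : ‖(inner ℝ v ξ : ℝ)‖ ^ 2 ≤ ‖v‖ ^ 2 * ‖ξ‖ ^ 2 := by
    rw [← mul_pow]
    exact pow_le_pow_left₀ (norm_nonneg _) (norm_inner_le_norm v ξ) 2
  have h2 : ‖v‖ ^ 2 ≤ 4 * Real.exp (1 / 4 * ‖v‖ ^ 2) := by
    have := Real.add_one_le_exp (1 / 4 * ‖v‖ ^ 2)
    linarith
  have h3 : Real.exp (-‖v‖ ^ 2 / 2)
      = Real.exp (-(1 / 4) * ‖v‖ ^ 2) * Real.exp (-(1 / 4) * ‖v‖ ^ 2) := by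
    rw [← Real.exp_add]; congr 1; ring
  have h4 : Real.exp (1 / 4 * ‖v‖ ^ 2) * Real.exp (-(1 / 4) * ‖v‖ ^ 2) = 1 := by
    rw [← Real.exp_add, ← Real.exp_zero]; congr 1; ring
  have hA : 0 ≤ (2 * Real.pi) ^ (-(3 / 2) : ℝ) := by positivity
  unfold maxwellian
  calc ‖(inner ℝ v ξ : ℝ)‖ ^ 2 * ((2 * Real.pi) ^ (-(3 / 2) : ℝ) * Real.exp (-‖v‖ ^ 2 / 2))
      ≤ (4 * Real.exp (1 / 4 * ‖v‖ ^ 2) * ‖ξ‖ ^ 2)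
          * ((2 * Real.pi) ^ (-(3 / 2) : ℝ) * Real.exp (-‖v‖ ^ 2 / 2)) := by
        refine mul_le_mul_of_nonneg_right (h1.trans ?_) (by positivity)
        exact mul_le_mul_of_nonneg_right h2 (by positivity)
    _ = 4 * ‖ξ‖ ^ 2 * (2 * Real.pi) ^ (-(3 / 2) : ℝ) * Real.exp (-(1 / 4) * ‖v‖ ^ 2)
          * (Real.exp (1 / 4 * ‖v‖ ^ 2) * Real.exp (-(1 / 4) * ‖v‖ ^ 2)) := by
        rw [h3]; ring
    _ = _ := by rw [h4, mul_one]

/-- `√M` as an element of `L²(ℝ³)`. -/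
def sqrtM : L2 := memLp_sqrtMFun.toLp sqrtMFun

/-- `(v·ξ) √M` as an element of `L²(ℝ³)`. -/
def vSqrtM (ξ : V3) : L2 := (memLp_mul_sqrtMFun ξ).toLp _

/-! ### The projections and the inner product of `L²_ξ` -/

/-- `P₀ f = (f, √M) √M`. -/
def P0 : L2 →L[ℂ] L2 := (innerSL ℂ sqrtM).smulRight sqrtM

/-- `P₁ = I - P₀`. -/
def P1 : L2 →L[ℂ] L2 := ContinuousLinearMap.id ℂ L2 - P0

/-- `(f, g)_ξ = (f, g) + |ξ|⁻² (P₀ f, P₀ g)`, linear in `f` and conjugate linear in `g`. For `ξ ≠ 0`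
its norm is equivalent to that of `L²(ℝ³)`. -/
def innerXi (ξ : V3) (f g : L2) : ℂ :=
  inner ℂ g f + ((‖ξ‖ ^ 2 : ℝ) : ℂ)⁻¹ * inner ℂ (P0 g) (P0 f)

/-! ### The operators -/

/-- `u ↦ Δu - |v|²/4 u + 3/2 u` on tempered distributions. -/
def distL : 𝓢'(V3, ℂ) →L[ℂ] 𝓢'(V3, ℂ) :=
  LineDeriv.laplacianCLM ℂ V3 𝓢'(V3, ℂ)
    - TemperedDistribution.smulLeftCLM ℂ (fun v : V3 => ((‖v‖ ^ 2 / 4 : ℝ) : ℂ))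
    + (3 / 2 : ℂ) • ContinuousLinearMap.id ℂ 𝓢'(V3, ℂ)

/-- The embedding `L²(ℝ³) → 𝓢'(ℝ³)`. -/
def toDist : L2 →L[ℂ] 𝓢'(V3, ℂ) := Lp.toTemperedDistributionCLM ℂ (volume : Measure V3) 2

/-- The graph of `L`: all pairs `(f, g)` in `L²` such that `Lf = g` in the sense of distributions. -/
def graphL : Submodule ℂ (L2 × L2) where
  carrier := {p | distL (toDist p.1) = toDist p.2}
  zero_mem' := by simp
  add_mem' := by
    intro a b ha hb
    simp only [Set.mem_ofPred_eq, Prod.fst_add, Prod.snd_add, map_add] at *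
    rw [ha, hb]
  smul_mem' := by
    intro c a ha
    simp only [Set.mem_ofPred_eq, Prod.smul_fst, Prod.smul_snd, map_smul] at *
    rw [ha]

/-- `L f = Δ_v f - |v|²/4 f + 3/2 f` with domain `{f ∈ L² | L f ∈ L²}`. -/
def opL : L2 →ₗ.[ℂ] L2 := graphL.toLinearPMap

lemma graph_opL : opL.graph = graphL := by
  refine Submodule.toLinearPMap_graph_eq _ ?_
  rintro ⟨f, g⟩ h hf
  simp only at hf
  subst hf
  have h' : distL (toDist 0) = toDist g := h
  rw [map_zero, map_zero] at h'
  have hk : g ∈ (toDist : L2 →L[ℂ] 𝓢'(V3, ℂ)).ker := h'.symm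
  rw [toDist, Lp.ker_toTemperedDistributionCLM_eq_bot] at hk
  simpa using hk

/-- The graph of multiplication by `v·ξ`. -/
def graphMul (ξ : V3) : Submodule ℂ (L2 × L2) where
  carrier := {p | p.2 =ᵐ[volume] fun v => ((inner ℝ v ξ : ℝ) : ℂ) * p.1 v}
  zero_mem' := by
    filter_upwards [Lp.coeFn_zero ℂ 2 (volume : Measure V3)] with v hv
    simp
  add_mem' := by
    intro a b ha hb
    simp only [Set.mem_ofPred_eq, Prod.fst_add, Prod.snd_add] at *
    filter_upwards [ha, hb, Lp.coeFn_add a.1 b.1, Lp.coeFn_add a.2 b.2] with v h1 h2 h3 h4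
    rw [h4, h3, Pi.add_apply, Pi.add_apply, h1, h2, mul_add]
  smul_mem' := by
    intro c a ha
    simp only [Set.mem_ofPred_eq, Prod.smul_fst, Prod.smul_snd] at *
    filter_upwards [ha, Lp.coeFn_smul c a.1, Lp.coeFn_smul c a.2] with v h1 h2 h3
    rw [h3, h2, Pi.smul_apply, Pi.smul_apply, h1, smul_eq_mul, smul_eq_mul]
    ring

/-- Multiplication by `v·ξ`, with domain `{f ∈ L² | (v·ξ) f ∈ L²}`. -/
def opMul (ξ : V3) : L2 →ₗ.[ℂ] L2 := (graphMul ξ).toLinearPMap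

lemma graph_opMul (ξ : V3) : (opMul ξ).graph = graphMul ξ := by
  refine Submodule.toLinearPMap_graph_eq _ ?_
  rintro ⟨f, g⟩ h hf
  simp only at hf
  subst hf
  have h' : g =ᵐ[volume] fun v => ((inner ℝ v ξ : ℝ) : ℂ) * (0 : L2) v := h
  refine Lp.ext ?_
  filter_upwards [h', Lp.coeFn_zero ℂ 2 (volume : Measure V3)] with v h1 h2
  rw [h1, h2]
  simp

lemma sqrtM_mem_graphMul (ξ : V3) : (sqrtM, vSqrtM ξ) ∈ graphMul ξ := by
  change vSqrtM ξ =ᵐ[volume] fun v => ((inner ℝ v ξ : ℝ) : ℂ) * sqrtM v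
  filter_upwards [(memLp_mul_sqrtMFun ξ).coeFn_toLp, memLp_sqrtMFun.coeFn_toLp] with v h1 h2
  rw [vSqrtM, h1, sqrtM, h2]

lemma P0_mem_domain (ξ : V3) (f : L2) : P0 f ∈ (opMul ξ).domain := by
  have h : sqrtM ∈ (opMul ξ).domain := by
    refine LinearPMap.mem_domain_of_mem_graph (y := vSqrtM ξ) ?_
    rw [graph_opMul]
    exact sqrtM_mem_graphMul ξ
  exact (opMul ξ).domain.smul_mem _ h

/-- `(v·ξ) P₀`, defined on all of `L²`. -/
def opMulP0 (ξ : V3) : L2 →ₗ.[ℂ] L2 :=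
  (opMul ξ).comp ((P0 : L2 →ₗ[ℂ] L2).toPMap ⊤) fun f => P0_mem_domain ξ f

/-- `B_ε(ξ) = L - i ε (v·ξ) - i ε (v·ξ) |ξ|⁻² P₀`, on the intersection of the domains of its terms. -/
def opB (ε : ℝ) (ξ : V3) : L2 →ₗ.[ℂ] L2 :=
  opL - (Complex.I * ε) • opMul ξ - (Complex.I * ε * ((‖ξ‖ ^ 2 : ℝ) : ℂ)⁻¹) • opMulP0 ξ

end

end VPFP

namespace VPFP

noncomputable section

/-! ### Weighted composition operators on `ℓ²` -/

section WeightedComp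

variable {ι : Type*}

/-! In an orthonormal basis of `ℝ³` whose first vector is `ξ/|ξ|`, Hermite functions diagonalize `L`
with eigenvalues `-deg α`, and `v·ξ` becomes `|ξ|` times a sum of two weighted shifts in the first
index. Substituting `f = (1 - L)⁻¹ u` turns `z - B_ε(ξ)` into a bounded operator `opT z a c` on
`ℓ²(ℕ³)`, with `a = ε|ξ|` and `c = ε/|ξ|` (`opB_iff`). This model no longer sees the direction of
`ξ`, so the eigenvalue depends on `|ξ|` and `ε` only.

Split `u` into its ground-state coordinate `u 0` and the rest. On the complement of the ground
state, `L ≤ -1`; hence for `Re z ≥ -1/2` and `|a| ≤ 1/16` the microscopic block `opG` is a small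
perturbation of an invertible diagonal operator (`isUnit_opG_of_re`). Eliminating this block (a
Schur complement) leaves one scalar equation `z + a(a+c) R(z,a) = 0`, where `R` is `dispR`
(`opT_eq_zero_iff`, `opT_bijective`). The Poisson term enters only through `μ = a(a+c) =
ε²(1+|ξ|²)`, which is small even though `c` may be large.

Since `R(0,0) = 1`, the implicit function theorem gives a root analytic in `(μ, a)`
(`exists_dispersion_root`); a Lipschitz bound on `R` makes it the only root in the whole half-plane
(`dispersion_root_unique`). The bound `R - 1 = O(|z| + |a|²)` (`norm_dispR_sub_one_le`) then yields
`z = -μ + O(μ²)`.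

The kernel vector of `opT` at the root is explicit and one-dimensional, which gives the
eigenfunction, its normalization and both expansions (`exists_eigenfunction`).

The passage to coefficients needs completeness of the Hermite functions and a description of the
maximal domains of `L` and of `v·ξ` by coefficients (`ae_eq_zero_of_pair_herm`, `mem_graphL_iff`,
`mem_graphMul_iff`). -/

lemma sum_weighted_comp_le {σ : ι → ι} {c : ι → ℂ} {C : ℝ} (hC : ∀ a, ‖c a‖ ≤ C)
    (hσ : Set.InjOn σ {a | c a ≠ 0}) (u : lp (fun _ : ι => ℂ) 2) (s : Finset ι) :
    ∑ a ∈ s, ‖c a * u (σ a)‖ ^ (2 : ℝ≥0∞).toReal ≤ (C * ‖u‖) ^ (2 : ℝ≥0∞).toReal := by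
  classical
  have h2 : (2 : ℝ≥0∞).toReal = ((2 : ℕ) : ℝ) := by norm_num
  simp only [h2, Real.rpow_natCast]
  calc ∑ a ∈ s, ‖c a * u (σ a)‖ ^ 2
      = ∑ a ∈ s with c a ≠ 0, ‖c a * u (σ a)‖ ^ 2 := by
        rw [Finset.sum_filter_of_ne]
        intro a _ h h0
        simp [h0] at h
    _ ≤ ∑ a ∈ s with c a ≠ 0, C ^ 2 * ‖u (σ a)‖ ^ 2 := by
        refine Finset.sum_le_sum fun a _ => ?_
        rw [norm_mul, mul_pow]
        gcongr
        exact hC a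
    _ = C ^ 2 * ∑ b ∈ (s.filter fun a => c a ≠ 0).image σ, ‖u b‖ ^ 2 := by
        rw [← Finset.mul_sum, Finset.sum_image]
        intro a ha b hb
        exact hσ (by simpa using (Finset.mem_filter.1 (Finset.mem_coe.1 ha)).2)
          (by simpa using (Finset.mem_filter.1 (Finset.mem_coe.1 hb)).2)
    _ ≤ C ^ 2 * ‖u‖ ^ 2 := by
        gcongr
        have := lp.sum_rpow_le_norm_rpow (p := 2) (by norm_num) u
          ((s.filter fun a => c a ≠ 0).image σ)
        simpa only [h2, Real.rpow_natCast] using this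
    _ = (C * ‖u‖) ^ 2 := by ring

/-- The operator `u ↦ (c_a u_{σ a})_a` on `ℓ²`, for bounded weights `c` and a map `σ` that is
injective where the weights do not vanish. -/
def weightedComp (σ : ι → ι) (c : ι → ℂ) (C : ℝ) (hC₀ : 0 ≤ C) (hC : ∀ a, ‖c a‖ ≤ C)
    (hσ : Set.InjOn σ {a | c a ≠ 0}) :
    lp (fun _ : ι => ℂ) 2 →L[ℂ] lp (fun _ : ι => ℂ) 2 :=
  LinearMap.mkContinuous
    { toFun := fun u => ⟨fun a => c a * u (σ a), memℓp_gen' (sum_weighted_comp_le hC hσ u)⟩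
      map_add' := fun u v => by
        ext a
        exact mul_add _ _ _
      map_smul' := fun k u => by
        ext a
        exact mul_left_comm _ _ _ } C
    fun u => lp.norm_le_of_forall_sum_le (by norm_num) (by positivity)
      (sum_weighted_comp_le hC hσ u)

lemma norm_weightedComp_le (σ : ι → ι) (c : ι → ℂ) (C : ℝ) (hC₀ : 0 ≤ C) (hC : ∀ a, ‖c a‖ ≤ C)
    (hσ : Set.InjOn σ {a | c a ≠ 0}) : ‖weightedComp σ c C hC₀ hC hσ‖ ≤ C :=
  LinearMap.mkContinuous_norm_le _ hC₀ _

/-- The diagonal operator with bounded entries `c`. -/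
def diagOp (c : ι → ℂ) (C : ℝ) (hC₀ : 0 ≤ C) (hC : ∀ a, ‖c a‖ ≤ C) :
    lp (fun _ : ι => ℂ) 2 →L[ℂ] lp (fun _ : ι => ℂ) 2 :=
  weightedComp id c C hC₀ hC (Set.injOn_id _)

@[simp]
lemma diagOp_apply (c : ι → ℂ) (C : ℝ) (hC₀ : 0 ≤ C) (hC : ∀ a, ‖c a‖ ≤ C)
    (u : lp (fun _ : ι => ℂ) 2) (a : ι) : diagOp c C hC₀ hC u a = c a * u a := rfl

lemma norm_diagOp_le (c : ι → ℂ) (C : ℝ) (hC₀ : 0 ≤ C) (hC : ∀ a, ‖c a‖ ≤ C) :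
    ‖diagOp c C hC₀ hC‖ ≤ C :=
  norm_weightedComp_le _ _ _ _ _ _

end WeightedComp

/-! ### The model operators on `ℓ²(ℕ³)` -/

/-- Multi-indices of Hermite functions on `ℝ³`. -/
abbrev Idx : Type := Fin 3 → ℕ

/-- Square summable coefficient families. -/
abbrev Ell : Type := lp (fun _ : Idx => ℂ) 2

/-- The degree of a multi-index. -/
def deg (α : Idx) : ℕ := ∑ j, α j

/-- The `j`-th unit multi-index. -/
abbrev unitIdx (j : Fin 3) : Idx := Pi.single j 1

/-- The unit vectors of `ℓ²(ℕ³)`. -/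
def dirac (α : Idx) : Ell := lp.single 2 α 1

lemma dirac_apply (α β : Idx) : dirac α β = if β = α then 1 else 0 := by
  rw [dirac, lp.single_apply, Pi.single_apply]

lemma norm_dirac (α : Idx) : ‖dirac α‖ = 1 := by
  rw [dirac, lp.norm_single (by norm_num), norm_one]

lemma deg_zero : deg 0 = 0 := by simp [deg]

lemma deg_eq_zero {α : Idx} : deg α = 0 ↔ α = 0 := by
  simp [deg, funext_iff]

lemma deg_add_unitIdx (α : Idx) (j : Fin 3) : deg (α + unitIdx j) = deg α + 1 := by
  simp [deg, Finset.sum_add_distrib]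

lemma le_deg (α : Idx) (j : Fin 3) : α j ≤ deg α :=
  Finset.single_le_sum (f := α) (fun _ _ => Nat.zero_le _) (Finset.mem_univ j)

lemma one_le_deg {α : Idx} (h : α ≠ 0) : 1 ≤ deg α :=
  Nat.one_le_iff_ne_zero.2 fun h' => h (deg_eq_zero.1 h')

lemma deg_unitIdx (j : Fin 3) : deg (unitIdx j) = 1 := by
  simpa [deg_zero] using deg_add_unitIdx 0 j

lemma unitIdx_ne_zero (j : Fin 3) : unitIdx j ≠ 0 := by
  intro h
  simpa using congrFun h j

lemma sub_unitIdx_injOn (j : Fin 3) :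
    Set.InjOn (fun α : Idx => α - unitIdx j) {α | α j ≠ 0} := by
  intro α hα β hβ h
  funext k
  have hk := congrFun h k
  simp only [Pi.sub_apply] at hk
  rcases eq_or_ne k j with rfl | hkj
  · simp only [Set.mem_ofPred_eq, Pi.single_eq_same] at hα hβ hk
    omega
  · simpa [Pi.single_eq_of_ne hkj] using hk

lemma sub_add_unitIdx {α : Idx} {j : Fin 3} (h : α j ≠ 0) : α - unitIdx j + unitIdx j = α := by
  funext k
  rcases eq_or_ne k j with rfl | hkj
  · simp only [Pi.add_apply, Pi.sub_apply, Pi.single_eq_same]; omega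
  · simp [Pi.single_eq_of_ne hkj]

lemma add_sub_unitIdx (α : Idx) (j : Fin 3) : α + unitIdx j - unitIdx j = α := by
  funext k; simp

/-- The smoothing operator `(1 - L)⁻¹`. -/
def opS : Ell →L[ℂ] Ell :=
  diagOp (fun α => ((1 + deg α : ℝ) : ℂ)⁻¹) 1 zero_le_one fun α => by
    rw [norm_inv, Complex.norm_real, Real.norm_of_nonneg (by positivity)]
    exact inv_le_one_of_one_le₀ (by simp)

lemma opS_apply (u : Ell) (α : Idx) : opS u α = ((1 + deg α : ℝ) : ℂ)⁻¹ * u α := rfl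

lemma norm_opS_le : ‖opS‖ ≤ 1 := norm_diagOp_le _ _ _ _

/-- Weight of the annihilation part of the multiplication by a coordinate, after smoothing. -/
def wUp (α : Idx) : ℂ := ((Real.sqrt (α 0 + 1) / (2 + deg α) : ℝ) : ℂ)

/-- Weight of the creation part of the multiplication by a coordinate, after smoothing. -/
def wDown (α : Idx) : ℂ := ((Real.sqrt (α 0) / deg α : ℝ) : ℂ)

/-- The ladder coefficients grow like the square root of the degree, so one factor `(1 - L)⁻¹`
absorbs them. This is the relative boundedness of `v·ξ` with respect to `L`. -/
lemma norm_wUp_le (α : Idx) : ‖wUp α‖ ≤ 1 := by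
  rw [wUp, Complex.norm_real, Real.norm_of_nonneg (by positivity)]
  refine div_le_one_of_le₀ (Real.sqrt_le_iff.2 ⟨by positivity, ?_⟩) (by positivity)
  have : (α 0 : ℝ) ≤ deg α := by exact_mod_cast le_deg α 0
  nlinarith

lemma norm_wDown_le (α : Idx) : ‖wDown α‖ ≤ 1 := by
  rw [wDown, Complex.norm_real, Real.norm_of_nonneg (by positivity)]
  refine div_le_one_of_le₀ (Real.sqrt_le_iff.2 ⟨by positivity, ?_⟩) (by positivity)
  have h : (α 0 : ℝ) ≤ deg α := by exact_mod_cast le_deg α 0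
  rcases Nat.eq_zero_or_pos (deg α) with h0 | h0
  · simp only [h0] at h ⊢; simpa using h
  · have : (1 : ℝ) ≤ deg α := by exact_mod_cast h0
    nlinarith

lemma wDown_ne_zero {α : Idx} (h : wDown α ≠ 0) : α 0 ≠ 0 := by
  intro h0
  simp [wDown, h0] at h

lemma wDown_zero : wDown 0 = 0 := by simp [wDown]

/-- Multiplication by the first coordinate, after smoothing. -/
def opW : Ell →L[ℂ] Ell :=
  weightedComp (fun α => α + unitIdx 0) wUp 1 zero_le_one norm_wUp_le (add_left_injective _).injOn
  + weightedComp (fun α => α - unitIdx 0) wDown 1 zero_le_one norm_wDown_le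
      ((sub_unitIdx_injOn 0).mono fun _ h => wDown_ne_zero h)

lemma opW_apply (u : Ell) (α : Idx) :
    opW u α = wUp α * u (α + unitIdx 0) + wDown α * u (α - unitIdx 0) := rfl

lemma norm_opW_le : ‖opW‖ ≤ 2 := by
  refine (norm_add_le _ _).trans ?_
  have := add_le_add (norm_weightedComp_le _ _ _ zero_le_one norm_wUp_le
      (add_left_injective (unitIdx 0)).injOn)
    (norm_weightedComp_le (fun α => α - unitIdx 0) wDown 1 zero_le_one norm_wDown_le
      ((sub_unitIdx_injOn 0).mono fun _ h => wDown_ne_zero h))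
  exact this.trans (by norm_num)

/-- The projection onto the orthogonal complement of the ground state. -/
def opQ : Ell →L[ℂ] Ell :=
  diagOp (fun α => if α = 0 then 0 else 1) 1 zero_le_one fun α => by split_ifs <;> simp

lemma opQ_apply (u : Ell) (α : Idx) : opQ u α = if α = 0 then 0 else u α := by
  rw [opQ, diagOp_apply]; split_ifs <;> simp

lemma norm_opQ_le : ‖opQ‖ ≤ 1 := norm_diagOp_le _ _ _ _

/-- The compression of `opW` to the orthogonal complement of the ground state. -/
def opW₁ : Ell →L[ℂ] Ell := opQ ∘L opW ∘L opQ

lemma norm_opW₁_le : ‖opW₁‖ ≤ 2 := by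
  calc ‖opW₁‖ ≤ ‖opQ‖ * (‖opW‖ * ‖opQ‖) :=
        (ContinuousLinearMap.opNorm_comp_le _ _).trans
          (mul_le_mul_of_nonneg_left (ContinuousLinearMap.opNorm_comp_le _ _) (norm_nonneg _))
    _ ≤ 1 * (2 * 1) := by
        gcongr
        exacts [norm_opQ_le, norm_opW_le, norm_opQ_le]
    _ = 2 := by norm_num

lemma norm_natCast_div_le (n : ℕ) : ‖((n / (1 + n) : ℝ) : ℂ)‖ ≤ 1 := by
  rw [Complex.norm_real, Real.norm_of_nonneg (by positivity)]
  exact div_le_one_of_le₀ (by linarith) (by positivity)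

/-- `-L (1 - L)⁻¹`. -/
def opN : Ell →L[ℂ] Ell :=
  diagOp (fun α => ((deg α / (1 + deg α) : ℝ) : ℂ)) 1 zero_le_one fun _ => norm_natCast_div_le _

lemma opN_apply (u : Ell) (α : Idx) : opN u α = ((deg α / (1 + deg α) : ℝ) : ℂ) * u α := rfl

/-- The operator `u ↦ u₀ δ_{e₀}`. -/
def opF : Ell →L[ℂ] Ell :=
  weightedComp (fun _ => 0) (fun α => if α = unitIdx 0 then 1 else 0) 1 zero_le_one
    (fun α => by split_ifs <;> simp) (by
      intro α hα β hβ _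
      simp only [ne_eq, ite_eq_right_iff, one_ne_zero, imp_false, not_not, Set.mem_ofPred_eq]
        at hα hβ
      rw [hα, hβ])

lemma opF_apply (u : Ell) (α : Idx) : opF u α = if α = unitIdx 0 then u 0 else 0 := by
  change (if α = unitIdx 0 then (1 : ℂ) else 0) * u 0 = _
  split_ifs <;> simp

/-- The model of `(z - B) (1 - L)⁻¹`. -/
def opT (z a c : ℂ) : Ell →L[ℂ] Ell :=
  opN + z • opS + (Complex.I * a) • opW + (Complex.I * c) • opF

/-- The microscopic part of `(z - B) (1 - L)⁻¹`, completed by the identity on the ground state. -/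
def opG (z a : ℂ) : Ell →L[ℂ] Ell :=
  (opN + (1 - opQ)) + z • (opS ∘L opQ) + (Complex.I * a) • opW₁

lemma opT_apply (z a c : ℂ) (u : Ell) (α : Idx) :
    opT z a c u α = ((deg α / (1 + deg α) : ℝ) : ℂ) * u α
      + z * (((1 + deg α : ℝ) : ℂ)⁻¹ * u α)
      + Complex.I * a * (wUp α * u (α + unitIdx 0) + wDown α * u (α - unitIdx 0))
      + Complex.I * c * (if α = unitIdx 0 then u 0 else 0) := by
  rw [← opF_apply]; rfl

lemma opW₁_apply (u : Ell) (α : Idx) :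
    opW₁ u α = if α = 0 then 0 else opW (opQ u) α := by
  rw [opW₁, ContinuousLinearMap.comp_apply, ContinuousLinearMap.comp_apply, opQ_apply]

lemma opG_apply (z a : ℂ) (u : Ell) (α : Idx) :
    opG z a u α = if α = 0 then u α else
      (((deg α / (1 + deg α) : ℝ) : ℂ) + z * ((1 + deg α : ℝ) : ℂ)⁻¹) * u α
        + Complex.I * a * opW (opQ u) α := by
  have : opG z a u α = opN u α + (u α - opQ u α) + z * opS (opQ u) α
      + Complex.I * a * opW₁ u α := rfl
  rw [this, opN_apply, opS_apply, opQ_apply, opW₁_apply]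
  split_ifs with h
  · simp [h, deg_zero]
  · ring

lemma opG_apply_zero (z a : ℂ) (u : Ell) : opG z a u 0 = u 0 := by
  rw [opG_apply, if_pos rfl]

/-- Inverse of the diagonal part of `opG`. -/
def diagInv (z : ℂ) (α : Idx) : ℂ := if α = 0 then 1 else ((1 + deg α : ℝ) : ℂ) / (z + deg α)

/-! ### Invertibility of the microscopic block and bounds on the dispersion function -/

lemma half_le_norm_add_deg {z : ℂ} (hz : -(1 / 2) ≤ z.re) {α : Idx} (_ : α ≠ 0) :
    (deg α : ℝ) - 1 / 2 ≤ ‖z + deg α‖ := by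
  refine le_trans ?_ (Complex.re_le_norm _)
  simp; linarith

/-- The worst case is degree one on the line `Re z = -1/2`, where the quotient can reach `2 / (1/2)
= 4`. -/
lemma norm_diagInv_le {z : ℂ} (hz : -(1 / 2) ≤ z.re) (α : Idx) : ‖diagInv z α‖ ≤ 4 := by
  rw [diagInv]
  split_ifs with h
  · simp
  · have h1 : (1 : ℝ) ≤ deg α := by exact_mod_cast one_le_deg h
    have h2 := half_le_norm_add_deg hz h
    rw [norm_div, Complex.norm_real, Real.norm_of_nonneg (by positivity), div_le_iff₀ (by linarith)]
    linarith

lemma diagInv_mul {z : ℂ} (hz : -(1 / 2) ≤ z.re) {α : Idx} (h : α ≠ 0) :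
    diagInv z α * (((deg α / (1 + deg α) : ℝ) : ℂ) + z * ((1 + deg α : ℝ) : ℂ)⁻¹) = 1 := by
  have h1 : (1 : ℝ) ≤ deg α := by exact_mod_cast one_le_deg h
  have h2 := half_le_norm_add_deg hz h
  have h3 : z + deg α ≠ 0 := norm_pos_iff.1 (by linarith)
  have h4 : (1 + deg α : ℂ) ≠ 0 := by
    have : ((1 + deg α : ℕ) : ℂ) ≠ 0 := Nat.cast_ne_zero.2 (by omega)
    simpa using this
  rw [diagInv, if_neg h]
  push_cast
  field_simp
  ring

/-- Neumann series: removing the diagonal leaves `1 + Y` with `‖Y‖ ≤ 4 · (1/16) · 2 = 1/2`, and the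
inverse is bounded by `4 / (1 - 1/2) = 8`. -/
lemma isUnit_opG_of_re {z a : ℂ} (hz : -(1 / 2) ≤ z.re) (ha : ‖a‖ ≤ 1 / 16) :
    IsUnit (opG z a) ∧ ‖Ring.inverse (opG z a)‖ ≤ 8 := by
  set D : Ell →L[ℂ] Ell := diagOp (diagInv z) 4 (by norm_num) (norm_diagInv_le hz) with hD
  set Y : Ell →L[ℂ] Ell := D * ((Complex.I * a) • opW₁) with hY
  have hDn : ‖D‖ ≤ 4 := norm_diagOp_le _ _ _ _
  have hYn : ‖Y‖ ≤ 1 / 2 := by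
    calc ‖Y‖ ≤ ‖D‖ * (‖Complex.I * a‖ * ‖opW₁‖) :=
          by
          rw [← norm_smul]; exact norm_mul_le _ _
      _ ≤ 4 * (1 / 16 * 2) := by
          gcongr
          · simpa using ha
          · exact norm_opW₁_le
      _ = 1 / 2 := by norm_num
  have hDG : D * opG z a = 1 + Y := by
    ext u α
    have h1 : (D * opG z a) u α = diagInv z α * opG z a u α := rfl
    have h2 : (1 + Y) u α = u α + diagInv z α * (Complex.I * a * opW₁ u α) := rfl
    rw [h1, h2, opG_apply, opW₁_apply]
    split_ifs with h
    · simp [h, diagInv]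
    · rw [mul_add, ← mul_assoc, diagInv_mul hz h, one_mul]
  -- The diagonal entries of `opG` are themselves bounded, by `1 + ‖z‖`, so they define a two-sided
  -- bounded inverse of `D`.
  have hDu : IsUnit D := by
    have hC : ∀ α : Idx, ‖(if α = 0 then 1 else
        (((deg α / (1 + deg α) : ℝ) : ℂ) + z * ((1 + deg α : ℝ) : ℂ)⁻¹))‖ ≤ 1 + ‖z‖ := by
      intro α
      split_ifs with h
      · simp
      · refine (norm_add_le _ _).trans (add_le_add (norm_natCast_div_le _) ?_)
        rw [norm_mul, norm_inv, Complex.norm_real, Real.norm_of_nonneg (by positivity)]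
        exact mul_le_of_le_one_right (norm_nonneg _) (inv_le_one_of_one_le₀ (by simp))
    refine ⟨⟨D, diagOp _ _ (by positivity) hC, ?_, ?_⟩, rfl⟩
    · ext u α
      change diagInv z α * ((if α = 0 then 1 else
        (((deg α / (1 + deg α) : ℝ) : ℂ) + z * ((1 + deg α : ℝ) : ℂ)⁻¹)) * u α) = u α
      split_ifs with h
      · simp [diagInv, h]
      · rw [← mul_assoc, diagInv_mul hz h, one_mul]
    · ext u α
      change (if α = 0 then 1 else
        (((deg α / (1 + deg α) : ℝ) : ℂ) + z * ((1 + deg α : ℝ) : ℂ)⁻¹)) * (diagInv z α * u α) = u α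
      split_ifs with h
      · simp [diagInv, h]
      · rw [← mul_assoc, mul_comm _ (diagInv z α), diagInv_mul hz h, one_mul]
  have hYu : IsUnit (1 + Y) := by
    have := isUnit_one_sub_of_norm_lt_one (x := -Y) (by rw [norm_neg]; linarith)
    simpa using this
  have hG : IsUnit (opG z a) := by
    obtain ⟨d, hd⟩ := hDu
    have : opG z a = ↑d⁻¹ * (1 + Y) := by
      rw [← hDG, ← hd, Units.inv_mul_cancel_left]
    rw [this]
    exact d⁻¹.isUnit.mul hYu
  refine ⟨hG, ContinuousLinearMap.opNorm_le_bound _ (by norm_num) fun g => ?_⟩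
  set u := Ring.inverse (opG z a) g with hu
  have hGu : opG z a u = g := by
    have := congrArg (fun T : Ell →L[ℂ] Ell => T g) (Ring.mul_inverse_cancel _ hG)
    exact this
  have h1 : D g = u + Y u := by
    have := congrArg (fun T : Ell →L[ℂ] Ell => T u) hDG
    change D (opG z a u) = u + Y u at this
    rwa [hGu] at this
  have h2 : ‖u‖ ≤ ‖D g‖ + ‖Y u‖ := by
    have : u = D g - Y u := by rw [h1]; abel
    calc ‖u‖ = ‖D g - Y u‖ := by rw [← this]
      _ ≤ _ := norm_sub_le _ _
  have h3 : ‖D g‖ ≤ 4 * ‖g‖ := (D.le_opNorm g).trans (by gcongr)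
  have h4 : ‖Y u‖ ≤ 1 / 2 * ‖u‖ := (Y.le_opNorm u).trans (by gcongr)
  linarith

/-- `G(z, a)⁻¹`. -/
def invG (z a : ℂ) : Ell →L[ℂ] Ell := Ring.inverse (opG z a)

lemma opG_invG {z a : ℂ} (hz : -(1 / 2) ≤ z.re) (ha : ‖a‖ ≤ 1 / 16) (g : Ell) :
    opG z a (invG z a g) = g :=
  congrArg (fun T : Ell →L[ℂ] Ell => T g) (Ring.mul_inverse_cancel _ (isUnit_opG_of_re hz ha).1)

lemma invG_opG {z a : ℂ} (hz : -(1 / 2) ≤ z.re) (ha : ‖a‖ ≤ 1 / 16) (g : Ell) :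
    invG z a (opG z a g) = g :=
  congrArg (fun T : Ell →L[ℂ] Ell => T g) (Ring.inverse_mul_cancel _ (isUnit_opG_of_re hz ha).1)

lemma norm_invG_le {z a : ℂ} (hz : -(1 / 2) ≤ z.re) (ha : ‖a‖ ≤ 1 / 16) (g : Ell) :
    ‖invG z a g‖ ≤ 8 * ‖g‖ :=
  ((invG z a).le_opNorm g).trans
    (mul_le_mul_of_nonneg_right (isUnit_opG_of_re hz ha).2 (norm_nonneg _))

lemma invG_apply_zero {z a : ℂ} (hz : -(1 / 2) ≤ z.re) (ha : ‖a‖ ≤ 1 / 16) (g : Ell) :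
    invG z a g 0 = g 0 := by
  rw [← opG_apply_zero z a, opG_invG hz ha]

/-- The vector `G(z, a)⁻¹ δ_{e₀}`. -/
def vecP (z a : ℂ) : Ell := invG z a (dirac (unitIdx 0))

/-- The scalar in the dispersion relation `z + μ r(z, a) = 0`. -/
def dispR (z a : ℂ) : ℂ := 1 / 2 * vecP z a (unitIdx 0)

lemma norm_vecP_le {z a : ℂ} (hz : -(1 / 2) ≤ z.re) (ha : ‖a‖ ≤ 1 / 16) : ‖vecP z a‖ ≤ 8 := by
  simpa [norm_dirac, vecP] using norm_invG_le hz ha (dirac (unitIdx 0))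

lemma vecP_apply_zero {z a : ℂ} (hz : -(1 / 2) ≤ z.re) (ha : ‖a‖ ≤ 1 / 16) : vecP z a 0 = 0 := by
  rw [vecP, invG_apply_zero hz ha, dirac_apply, if_neg (unitIdx_ne_zero 0).symm]

lemma norm_apply_le (u : Ell) (α : Idx) : ‖u α‖ ≤ ‖u‖ :=
  lp.norm_apply_le_norm (by norm_num) u α

lemma norm_dispR_le {z a : ℂ} (hz : -(1 / 2) ≤ z.re) (ha : ‖a‖ ≤ 1 / 16) : ‖dispR z a‖ ≤ 4 := by
  have := (norm_apply_le (vecP z a) (unitIdx 0)).trans (norm_vecP_le hz ha)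
  rw [dispR, norm_mul]
  norm_num
  linarith

/-- Resolvent identity in `z`: two factors bounded by 8 and the prefactor `1/2` give 32. -/
lemma norm_dispR_sub_le {z z' a : ℂ} (hz : -(1 / 2) ≤ z.re) (hz' : -(1 / 2) ≤ z'.re)
    (ha : ‖a‖ ≤ 1 / 16) : ‖dispR z a - dispR z' a‖ ≤ 32 * ‖z - z'‖ := by
  have h : vecP z a - vecP z' a = (z' - z) • invG z a (opS (opQ (vecP z' a))) := by
    have h1 : opG z a (vecP z' a)
        = opG z' a (vecP z' a) + (z - z') • opS (opQ (vecP z' a)) := by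
      simp only [opG, add_apply, smul_apply,
        ContinuousLinearMap.comp_apply, sub_smul]
      abel
    have h2 := congrArg (invG z a) h1
    rw [invG_opG hz ha, map_add, map_smul, vecP, opG_invG hz' ha] at h2
    rw [← neg_sub z z', neg_smul]
    nth_rw 2 [vecP]
    rw [h2]
    simp only [vecP]
    abel
  have h3 : ‖vecP z a - vecP z' a‖ ≤ ‖z - z'‖ * (8 * 8) := by
    rw [h, norm_smul, norm_sub_rev]
    gcongr
    refine (norm_invG_le hz ha _).trans ?_
    gcongr
    calc ‖opS (opQ (vecP z' a))‖ ≤ 1 * ‖opQ (vecP z' a)‖ :=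
          (opS.le_opNorm _).trans (by gcongr; exact norm_opS_le)
      _ ≤ 1 * (1 * ‖vecP z' a‖) := by
          gcongr
          exact (opQ.le_opNorm _).trans (by gcongr; exact norm_opQ_le)
      _ ≤ 8 := by simpa using norm_vecP_le hz' ha
  have h4 := norm_apply_le (vecP z a - vecP z' a) (unitIdx 0)
  have h5 : dispR z a - dispR z' a = 1 / 2 * (vecP z a - vecP z' a) (unitIdx 0) := by
    rw [lp.coeFn_sub, Pi.sub_apply, dispR, dispR]; ring
  rw [h5, norm_mul]
  have h6 : ‖(1 / 2 : ℂ)‖ = 1 / 2 := by norm_num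
  rw [h6]
  linarith

lemma opQ_dirac {α : Idx} (h : α ≠ 0) : opQ (dirac α) = dirac α := by
  ext β
  rw [opQ_apply, dirac_apply]
  split_ifs with h1 h2 <;> simp_all

lemma opG_dirac (z a : ℂ) {α : Idx} (h : α ≠ 0) :
    opG z a (dirac α) = (((deg α / (1 + deg α) : ℝ) : ℂ) + z * ((1 + deg α : ℝ) : ℂ)⁻¹) • dirac α
      + (Complex.I * a) • opW₁ (dirac α) := by
  ext β
  have : ((((deg α / (1 + deg α) : ℝ) : ℂ) + z * ((1 + deg α : ℝ) : ℂ)⁻¹) • dirac α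
      + (Complex.I * a) • opW₁ (dirac α) : Ell) β
      = (((deg α / (1 + deg α) : ℝ) : ℂ) + z * ((1 + deg α : ℝ) : ℂ)⁻¹) * dirac α β
        + Complex.I * a * opW₁ (dirac α) β := rfl
  rw [this, opG_apply, opW₁_apply, dirac_apply]
  split_ifs with h1 h2 h2 <;> simp_all

/-- At degree one the diagonal entry of `opG` is `(1 + z)/2`. Solving for `vecP` and doubling
isolates its leading value `2 δ` with explicit corrections in `z` and `a`. -/
lemma vecP_eq {z a : ℂ} (hz : -(1 / 2) ≤ z.re) (ha : ‖a‖ ≤ 1 / 16) :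
    vecP z a = (2 : ℂ) • dirac (unitIdx 0) - z • vecP z a
      - (2 * (Complex.I * a)) • invG z a (opW₁ (dirac (unitIdx 0))) := by
  have h := congrArg (invG z a) (opG_dirac z a (unitIdx_ne_zero 0))
  rw [invG_opG hz ha, map_add, map_smul, map_smul, deg_unitIdx] at h
  change dirac (unitIdx 0) = _ • vecP z a + _ at h
  generalize invG z a (opW₁ (dirac (unitIdx 0))) = q at h ⊢
  rw [h, smul_add, smul_smul, smul_smul]
  push_cast
  match_scalars <;> ring

lemma invG_dirac_eq {z a : ℂ} (hz : -(1 / 2) ≤ z.re) (ha : ‖a‖ ≤ 1 / 16) {α : Idx} (h : α ≠ 0) :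
    invG z a (dirac α)
      = diagInv z α • (dirac α - (Complex.I * a) • invG z a (opW₁ (dirac α))) := by
  have h1 := congrArg (invG z a) (opG_dirac z a h)
  rw [invG_opG hz ha, map_add, map_smul, map_smul] at h1
  nth_rw 2 [h1]
  rw [add_sub_cancel_right, smul_smul, diagInv_mul hz h, one_smul]

/-- The lower neighbour of `unitIdx 0` is the ground state, which the projection removes; only the
creation term survives. -/
lemma opW₁_dirac_unitIdx :
    opW₁ (dirac (unitIdx 0)) = wDown (unitIdx 0 + unitIdx 0) • dirac (unitIdx 0 + unitIdx 0) := by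
  ext α
  change _ = wDown (unitIdx 0 + unitIdx 0) * dirac (unitIdx 0 + unitIdx 0) α
  rw [opW₁_apply, opQ_dirac (unitIdx_ne_zero 0), opW_apply, dirac_apply, dirac_apply, dirac_apply]
  have h0 : ¬ (0 = unitIdx 0 + unitIdx 0) := fun h => by simpa using congrFun h 0
  rcases eq_or_ne α 0 with rfl | hα
  · simp [h0]
  · have h1 : ¬ α + unitIdx 0 = unitIdx 0 := fun h => hα (by simpa using h)
    rw [if_neg hα, if_neg h1, mul_zero, zero_add]
    by_cases h2 : α = unitIdx 0 + unitIdx 0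
    · rw [if_pos h2, h2, add_sub_unitIdx, if_pos rfl]
    · rw [if_neg h2, mul_zero]
      by_cases h3 : α 0 = 0
      · simp [wDown, h3]
      · rw [if_neg, mul_zero]
        intro h4
        exact h2 (by rw [← sub_add_unitIdx h3, h4])

lemma norm_opW₁_dirac_le (α : Idx) : ‖opW₁ (dirac α)‖ ≤ 2 := by
  have := (opW₁.le_opNorm (dirac α)).trans
    (mul_le_mul_of_nonneg_right norm_opW₁_le (norm_nonneg _))
  simpa [norm_dirac] using this

/-- Parity gains a power of `a`: `opW₁` sends the degree-one vector to degree two, and the leading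
part of `invG` there is diagonal, so returning to `unitIdx 0` costs another `opW₁`. This makes the
correction to `dispR` quadratic in `a`, as the `ε⁴` error requires. -/
lemma norm_invG_opW₁_apply_le {z a : ℂ} (hz : -(1 / 2) ≤ z.re) (ha : ‖a‖ ≤ 1 / 16) :
    ‖invG z a (opW₁ (dirac (unitIdx 0))) (unitIdx 0)‖ ≤ 64 * ‖a‖ := by
  set α : Idx := unitIdx 0 + unitIdx 0 with hα
  have hα0 : α ≠ 0 := fun h => by simpa [hα] using congrFun h 0
  have hα1 : unitIdx 0 ≠ α := fun h => by simpa [hα] using congrFun h 0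
  have h2 : invG z a (opW₁ (dirac (unitIdx 0))) (unitIdx 0)
      = wDown α * (diagInv z α * (0 - Complex.I * a * invG z a (opW₁ (dirac α)) (unitIdx 0))) := by
    rw [opW₁_dirac_unitIdx, ← hα, map_smul, invG_dirac_eq hz ha hα0]
    change wDown α * (diagInv z α * (dirac α (unitIdx 0) - _)) = _
    rw [dirac_apply, if_neg hα1]
    rfl
  have h3 : ‖invG z a (opW₁ (dirac α)) (unitIdx 0)‖ ≤ 16 := by
    refine (norm_apply_le _ _).trans ((norm_invG_le hz ha _).trans ?_)
    linarith [norm_opW₁_dirac_le α]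
  rw [h2, zero_sub, norm_mul, norm_mul, norm_neg, norm_mul, norm_mul, Complex.norm_I, one_mul]
  calc _ ≤ 1 * (4 * (‖a‖ * 16)) := by
        gcongr
        exacts [norm_wDown_le _, norm_diagInv_le hz _]
    _ = _ := by ring

lemma norm_dispR_sub_one_le {z a : ℂ} (hz : -(1 / 2) ≤ z.re) (ha : ‖a‖ ≤ 1 / 16) :
    ‖dispR z a - 1‖ ≤ 64 * (‖z‖ + ‖a‖ ^ 2) := by
  have h1 : vecP z a (unitIdx 0) = 2 * 1 - z * vecP z a (unitIdx 0)
      - 2 * (Complex.I * a) * invG z a (opW₁ (dirac (unitIdx 0))) (unitIdx 0) := by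
    have := congrArg (fun u : Ell => u (unitIdx 0)) (vecP_eq hz ha)
    have h0 : dirac (unitIdx 0) (unitIdx 0) = 1 := by rw [dirac_apply, if_pos rfl]
    rw [← h0]
    exact this
  have h2 : dispR z a - 1 = -(z * dispR z a)
      - Complex.I * a * invG z a (opW₁ (dirac (unitIdx 0))) (unitIdx 0) := by
    simp only [dispR]
    linear_combination (1 / 2 : ℂ) * h1
  rw [h2]
  refine (norm_sub_le _ _).trans ?_
  rw [norm_neg, norm_mul, norm_mul, norm_mul, Complex.norm_I, one_mul]
  have h3 := norm_dispR_le hz ha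
  have h4 := norm_invG_opW₁_apply_le hz ha
  calc _ ≤ ‖z‖ * 4 + ‖a‖ * (64 * ‖a‖) := by gcongr
    _ ≤ _ := by nlinarith [norm_nonneg z]

lemma opS_dirac (α : Idx) : opS (dirac α) = ((1 + deg α : ℝ) : ℂ)⁻¹ • dirac α := by
  ext β
  change _ = _ * dirac α β
  rw [opS_apply, dirac_apply]
  split_ifs with h <;> simp [h]

lemma norm_opS_apply_le (u : Ell) : ‖opS u‖ ≤ ‖u‖ :=
  (opS.le_opNorm u).trans (mul_le_of_le_one_left (norm_nonneg _) norm_opS_le)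

/-- `vecP` is close to twice the unit vector, and `opS` halves degree one. Here first order in `a`
is enough, since the whole vector is compared and degree two does contribute. -/
lemma norm_opS_vecP_sub_le {z a : ℂ} (hz : -(1 / 2) ≤ z.re) (ha : ‖a‖ ≤ 1 / 16) :
    ‖opS (vecP z a) - dirac (unitIdx 0)‖ ≤ 32 * (‖z‖ + ‖a‖) := by
  have h1 : opS (vecP z a) - dirac (unitIdx 0) = -(z • opS (vecP z a)
      + (2 * (Complex.I * a)) • opS (invG z a (opW₁ (dirac (unitIdx 0))))) := by
    have h := congrArg opS (vecP_eq hz ha)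
    rw [map_sub, map_sub, map_smul, map_smul, map_smul, opS_dirac, deg_unitIdx, smul_smul] at h
    have h2 : (2 * ((1 + (1 : ℕ) : ℝ) : ℂ)⁻¹) = (1 : ℂ) := by push_cast; norm_num
    rw [h2, one_smul] at h
    nth_rw 1 [h]
    abel
  rw [h1, norm_neg]
  refine (norm_add_le _ _).trans ?_
  rw [norm_smul, norm_smul, norm_mul, norm_mul, Complex.norm_I, one_mul]
  have h3 := (norm_opS_apply_le _).trans (norm_vecP_le hz ha)
  have h4 : ‖opS (invG z a (opW₁ (dirac (unitIdx 0))))‖ ≤ 8 * 2 :=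
    (norm_opS_apply_le _).trans ((norm_invG_le hz ha _).trans (by
      gcongr
      exact norm_opW₁_dirac_le _))
  have h5 : ‖(2 : ℂ)‖ = 2 := by norm_num
  rw [h5]
  calc _ ≤ ‖z‖ * 8 + 2 * ‖a‖ * (8 * 2) := by gcongr
    _ ≤ _ := by nlinarith [norm_nonneg z, norm_nonneg a]

/-! ### Inversion of the model operator -/

lemma wUp_zero : wUp 0 = 1 / 2 := by
  simp [wUp, deg_zero]

lemma wDown_unitIdx : wDown (unitIdx 0) = 1 := by
  simp [wDown, deg_unitIdx]

/-- Block decomposition of `T` along the ground state and its complement. -/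
lemma opT_eq (z a c : ℂ) (u : Ell) :
    opT z a c u = (z * u 0 + Complex.I * a / 2 * (u - u 0 • dirac 0) (unitIdx 0)) • dirac 0
      + opG z a (u - u 0 • dirac 0) + (Complex.I * (a + c) * u 0) • dirac (unitIdx 0) := by
  have hQ : ∀ β, opQ (u - u 0 • dirac 0) β = u β - u 0 * dirac 0 β := by
    intro β
    rw [opQ_apply]
    split_ifs with h
    · rw [h, dirac_apply, if_pos rfl, mul_one, sub_self]
    · rfl
  have hw : ∀ β, (u - u 0 • dirac 0 : Ell) β = u β - u 0 * dirac 0 β := fun β => rfl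
  ext α
  change _ = _ * dirac 0 α + opG z a (u - u 0 • dirac 0) α + _ * dirac (unitIdx 0) α
  rw [opT_apply, opG_apply, opW_apply, hQ, hQ, hw, hw]
  simp only [dirac_apply]
  rcases eq_or_ne α 0 with rfl | hα
  · have h1 : ¬ (0 = unitIdx 0) := (unitIdx_ne_zero 0).symm
    simp only [deg_zero, wUp_zero, wDown_zero, if_neg h1, if_true, zero_add,
      if_neg (unitIdx_ne_zero 0)]
    simp
    ring
  · have h2 : ¬ α + unitIdx 0 = 0 := fun h => by simpa using congrFun h 0
    simp only [if_neg hα, if_neg h2]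
    by_cases h3 : α = unitIdx 0
    · subst h3
      simp only [if_true, tsub_self, wDown_unitIdx]
      ring
    · have h4 : wDown α * (if α - unitIdx 0 = 0 then (1 : ℂ) else 0) = 0 := by
        by_cases h5 : α 0 = 0
        · simp [wDown, h5]
        · rw [if_neg, mul_zero]
          intro h6
          exact h3 (by rw [← sub_add_unitIdx h5, h6, zero_add])
      simp only [if_neg h3]
      linear_combination (Complex.I * a * u 0) * h4

/-- Schur complement: the microscopic equation expresses `u - u 0 • dirac 0` through `vecP`, and
inserting this in the ground-state coordinate gives the dispersion relation. The product of the two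
factors `I` turns the coupling into `+a(a+c)`. -/
lemma opT_eq_zero_iff {z a c : ℂ} (hz : -(1 / 2) ≤ z.re) (ha : ‖a‖ ≤ 1 / 16) (u : Ell) :
    opT z a c u = 0 ↔ (z + a * (a + c) * dispR z a) * u 0 = 0
      ∧ u = u 0 • dirac 0 - (Complex.I * (a + c) * u 0) • vecP z a := by
  rw [opT_eq]
  set w : Ell := u - u 0 • dirac 0 with hw
  have hw0 : w 0 = 0 := by
    change u 0 - u 0 * dirac 0 0 = 0
    rw [dirac_apply, if_pos rfl, mul_one, sub_self]
  have hd1 : dirac (unitIdx 0) 0 = 0 := by rw [dirac_apply, if_neg (unitIdx_ne_zero 0).symm]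
  have hd0 : dirac 0 0 = 1 := by rw [dirac_apply, if_pos rfl]
  have hI := Complex.I_mul_I
  constructor
  · intro h
    have h0 : z * u 0 + Complex.I * a / 2 * w (unitIdx 0) = 0 := by
      have h1 : (z * u 0 + Complex.I * a / 2 * w (unitIdx 0)) * dirac 0 0 + opG z a w 0
          + Complex.I * (a + c) * u 0 * dirac (unitIdx 0) 0 = 0 :=
        congrArg (fun v : Ell => v 0) h
      rwa [opG_apply_zero, hw0, hd1, hd0, mul_one, mul_zero, add_zero, add_zero] at h1
    rw [h0, zero_smul, zero_add] at h
    have h2 := congrArg (invG z a) h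
    rw [map_add, invG_opG hz ha, map_smul, map_zero] at h2
    change w + _ • vecP z a = 0 at h2
    have h3 : w = -((Complex.I * (a + c) * u 0) • vecP z a) := eq_neg_of_add_eq_zero_left h2
    refine ⟨?_, ?_⟩
    · have h4 : w (unitIdx 0) = -(Complex.I * (a + c) * u 0 * vecP z a (unitIdx 0)) :=
        congrArg (fun v : Ell => v (unitIdx 0)) h3
      rw [h4] at h0
      rw [dispR]
      linear_combination h0 + a * (a + c) * u 0 * vecP z a (unitIdx 0) / 2 * hI
    · rw [sub_eq_add_neg, ← h3, hw]; abel
  · rintro ⟨h1, h2⟩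
    have h3 : w = -((Complex.I * (a + c) * u 0) • vecP z a) := by
      generalize u 0 = k at h2 hw ⊢
      rw [hw, h2]
      abel
    have h4 : w (unitIdx 0) = -(Complex.I * (a + c) * u 0 * vecP z a (unitIdx 0)) :=
      congrArg (fun v : Ell => v (unitIdx 0)) h3
    have h5 : z * u 0 + Complex.I * a / 2 * w (unitIdx 0) = 0 := by
      rw [h4]
      rw [dispR] at h1
      linear_combination h1 - a * (a + c) * u 0 * vecP z a (unitIdx 0) / 2 * hI
    rw [h5, zero_smul, zero_add, h3, map_neg, map_smul, vecP, opG_invG hz ha]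
    abel

lemma opT_bijective {z a c : ℂ} (hz : -(1 / 2) ≤ z.re) (ha : ‖a‖ ≤ 1 / 16)
    (hd : z + a * (a + c) * dispR z a ≠ 0) : Function.Bijective (opT z a c) := by
  constructor
  · rw [injective_iff_map_eq_zero]
    intro u hu
    obtain ⟨h1, h2⟩ := (opT_eq_zero_iff hz ha u).1 hu
    have h0 : u 0 = 0 := (mul_eq_zero.1 h1).resolve_left hd
    rw [h2, h0]
    simp
  · intro g
    set y : Ell := invG z a (g - g 0 • dirac 0) with hy
    set p : Ell := vecP z a with hp
    -- The ground-state coordinate of the preimage, forced by the scalar equation once the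
    -- microscopic part has been eliminated.
    set k : ℂ := (z + a * (a + c) * dispR z a)⁻¹ * (g 0 - Complex.I * a / 2 * y (unitIdx 0))
      with hk
    have hd0 : dirac 0 0 = 1 := by rw [dirac_apply, if_pos rfl]
    have hy0 : y 0 = 0 := by
      rw [hy, invG_apply_zero hz ha]
      change g 0 - g 0 * dirac 0 0 = 0
      rw [hd0, mul_one, sub_self]
    have hp0 : p 0 = 0 := vecP_apply_zero hz ha
    refine ⟨k • dirac 0 + y - (Complex.I * (a + c) * k) • p, ?_⟩
    set u : Ell := k • dirac 0 + y - (Complex.I * (a + c) * k) • p with hu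
    have hu0 : u 0 = k := by
      change k * dirac 0 0 + y 0 - Complex.I * (a + c) * k * p 0 = k
      rw [hd0, hy0, hp0]; ring
    have hw : u - u 0 • dirac 0 = y - (Complex.I * (a + c) * k) • p := by
      rw [hu0, hu]; abel
    have hG : opG z a (y - (Complex.I * (a + c) * k) • p)
        = g - g 0 • dirac 0 - (Complex.I * (a + c) * k) • dirac (unitIdx 0) := by
      rw [map_sub, map_smul, hy, opG_invG hz ha, hp, vecP, opG_invG hz ha]
    have he : (y - (Complex.I * (a + c) * k) • p : Ell) (unitIdx 0)
        = y (unitIdx 0) - Complex.I * (a + c) * k * p (unitIdx 0) := rfl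
    have hk' : (z + a * (a + c) * dispR z a) * k = g 0 - Complex.I * a / 2 * y (unitIdx 0) := by
      rw [hk, mul_inv_cancel_left₀ hd]
    have hs : z * k + Complex.I * a / 2 * (y (unitIdx 0) - Complex.I * (a + c) * k * p (unitIdx 0))
        = g 0 := by
      rw [dispR, ← hp] at hk'
      linear_combination hk' - a * (a + c) * k * p (unitIdx 0) / 2 * Complex.I_mul_I
    rw [opT_eq, hw, hG, he, hu0, hs]
    abel

/-! ### The eigenvalue as a smooth function -/

/-- `opG` is affine in `(z, a)` and inversion is analytic at a unit. -/
lemma contDiffAt_dispR : ContDiffAt ℂ ω (fun p : ℂ × ℂ => dispR p.1 p.2) 0 := by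
  have hu : IsUnit (opG 0 0) := (isUnit_opG_of_re (by norm_num) (by norm_num)).1
  have hG : ContDiff ℂ ω (fun p : ℂ × ℂ => opG p.1 p.2) := by
    unfold opG
    fun_prop
  have hI : ContDiffAt ℂ ω (Ring.inverse : (Ell →L[ℂ] Ell) → (Ell →L[ℂ] Ell)) (opG 0 0) := by
    obtain ⟨g, hg⟩ := hu
    rw [← hg]
    exact contDiffAt_ringInverse ℂ g
  have hc : ContDiffAt ℂ ω (fun p : ℂ × ℂ => invG p.1 p.2) 0 :=
    ContDiffAt.comp (g := Ring.inverse) (f := fun p : ℂ × ℂ => opG p.1 p.2) 0 hI hG.contDiffAt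
  let ev : Ell →L[ℂ] ℂ := lp.evalCLM ℂ (fun _ : Idx => ℂ) 2 (unitIdx 0)
  have h2 : ContDiffAt ℂ ω (fun p : ℂ × ℂ => ev (invG p.1 p.2 (dirac (unitIdx 0)))) 0 :=
    ev.contDiff.contDiffAt.comp _ (hc.clm_apply contDiffAt_const)
  exact contDiffAt_const.mul h2

/-- The parameters `q = (μ, a)` are treated as independent. At `q = 0` the equation reads `z = 0`,
with derivative one in `z`, so the implicit function theorem applies. -/
lemma exists_dispersion_root :
    ∃ ρ : ℝ, 0 < ρ ∧ ∃ Λ : ℂ × ℂ → ℂ, ∀ q : ℂ × ℂ, ‖q‖ < ρ →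
      ContDiffAt ℂ ω Λ q ∧ -(1 / 2) < (Λ q).re ∧ Λ q + q.1 * dispR (Λ q) q.2 = 0 := by
  let f : (ℂ × ℂ) × ℂ → ℂ := fun x => x.2 + x.1.1 * dispR x.2 x.1.2
  have cdf : ContDiffAt ℂ ω f 0 := by
    have h := ContDiffAt.comp (g := fun p : ℂ × ℂ => dispR p.1 p.2)
      (f := fun x : (ℂ × ℂ) × ℂ => (x.2, x.1.2)) 0 contDiffAt_dispR (by fun_prop)
    exact contDiffAt_snd.add ((contDiffAt_fst.comp _ contDiffAt_fst).mul h)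
  have hω : (ω : WithTop ℕ∞) ≠ 0 := by simp
  have if₂ : (fderiv ℂ f 0 ∘L .inr ℂ (ℂ × ℂ) ℂ).IsInvertible := by
    have h1 : fderiv ℂ f 0 ∘L .inr ℂ (ℂ × ℂ) ℂ = ContinuousLinearMap.id ℂ ℂ := by
      have hd : HasFDerivAt f (fderiv ℂ f 0) (ContinuousLinearMap.inr ℂ (ℂ × ℂ) ℂ 0) := by
        rw [map_zero]
        exact (cdf.differentiableAt hω).hasFDerivAt
      have h2 := hd.comp (0 : ℂ) (ContinuousLinearMap.inr ℂ (ℂ × ℂ) ℂ).hasFDerivAt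
      have h3 : f ∘ ContinuousLinearMap.inr ℂ (ℂ × ℂ) ℂ = id := by
        funext z
        simp [f]
      rw [h3] at h2
      exact h2.unique (hasFDerivAt_id 0)
    rw [h1]
    exact ⟨ContinuousLinearEquiv.refl ℂ ℂ, rfl⟩
  have hΛ := cdf.contDiffAt_implicitFunction hω if₂
  have h0 : cdf.implicitFunction hω if₂ 0 = 0 := cdf.implicitFunction_apply_self hω if₂
  -- Analyticity at a point persists nearby, and likewise finite smoothness; `ContDiffAt` of order
  -- `∞` at one point need not. Hence the regularity `ω` up to here.
  have e1 := hΛ.eventually (by simp)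
  have e2 := cdf.eventually_apply_implicitFunction hω if₂
  have e3 : ∀ᶠ q in nhds (0 : ℂ × ℂ), -(1 / 2) < (cdf.implicitFunction hω if₂ q).re := by
    have hc : ContinuousAt (fun q => (cdf.implicitFunction hω if₂ q).re) 0 :=
      Complex.continuous_re.continuousAt.comp hΛ.continuousAt
    exact hc.eventually (lt_mem_nhds (by beta_reduce; rw [h0]; norm_num))
  obtain ⟨ρ, hρ, h⟩ := Metric.eventually_nhds_iff.1 (e1.and (e2.and e3))
  refine ⟨ρ, hρ, cdf.implicitFunction hω if₂, fun q hq => ?_⟩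
  obtain ⟨h1, h2, h3⟩ := h (y := q) (by simpa using hq)
  exact ⟨h1, h3, by simpa [f] using h2⟩

/-- The map `z ↦ -μ R(z,a)` has Lipschitz constant at most `32/64 = 1/2`. This covers the whole
half-plane, whereas the implicit function theorem sees only small `z`. -/
lemma dispersion_root_unique {z z' a μ : ℂ} (hz : -(1 / 2) ≤ z.re) (hz' : -(1 / 2) ≤ z'.re)
    (ha : ‖a‖ ≤ 1 / 16) (hμ : ‖μ‖ ≤ 1 / 64) (h : z + μ * dispR z a = 0)
    (h' : z' + μ * dispR z' a = 0) : z = z' := by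
  have h1 : z - z' = -(μ * (dispR z a - dispR z' a)) := by linear_combination h - h'
  have h2 : ‖z - z'‖ ≤ 1 / 64 * (32 * ‖z - z'‖) := by
    nth_rw 1 [h1]
    rw [norm_neg, norm_mul]
    gcongr
    exact norm_dispR_sub_le hz hz' ha
  have h3 : ‖z - z'‖ ≤ 0 := by linarith
  exact sub_eq_zero.1 (norm_le_zero_iff.1 h3)

lemma norm_dispersion_root_le {z a μ : ℂ} (hz : -(1 / 2) ≤ z.re) (ha : ‖a‖ ≤ 1 / 16)
    (h : z + μ * dispR z a = 0) : ‖z‖ ≤ 4 * ‖μ‖ := by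
  rw [eq_neg_of_add_eq_zero_left h, norm_neg, norm_mul, mul_comm]
  gcongr
  exact norm_dispR_le hz ha

lemma norm_dispersion_root_add_le {z a μ : ℂ} (hz : -(1 / 2) ≤ z.re) (ha : ‖a‖ ≤ 1 / 16)
    (h : z + μ * dispR z a = 0) : ‖z + μ‖ ≤ 256 * ‖μ‖ * (‖μ‖ + ‖a‖ ^ 2) := by
  have h1 : z + μ = -(μ * (dispR z a - 1)) := by linear_combination h
  have h2 := norm_dispR_sub_one_le hz ha
  have h3 := norm_dispersion_root_le hz ha h
  rw [h1, norm_neg, norm_mul]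
  calc ‖μ‖ * ‖dispR z a - 1‖ ≤ ‖μ‖ * (64 * (4 * ‖μ‖ + ‖a‖ ^ 2)) := by
        gcongr
        exact h2.trans (by gcongr)
    _ ≤ _ := by nlinarith [norm_nonneg μ, mul_nonneg (norm_nonneg μ) (sq_nonneg ‖a‖)]

/-- The parameter region is unbounded in `s`, but `a = εs` and `μ = ε²(1+s²)` stay small on it
because `1 + s² ≤ (1 + |s|)²`. -/
lemma abs_sq_mul_le {r s ε : ℝ} (hr : 0 ≤ r) (hr1 : r ≤ 1 / 16) (h : |ε| * (1 + |s|) ≤ r) :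
    |ε * s| ≤ r ∧ ε ^ 2 * (1 + s ^ 2) ≤ r ∧ ε ^ 2 * (1 + s ^ 2) ≤ 1 / 256 := by
  have h1 : |ε * s| ≤ |ε| * (1 + |s|) := by
    rw [abs_mul]; nlinarith [abs_nonneg ε]
  have h2 : ε ^ 2 * (1 + s ^ 2) ≤ (|ε| * (1 + |s|)) ^ 2 := by
    rw [mul_pow, sq_abs]
    gcongr
    nlinarith [sq_abs s, abs_nonneg s]
  have h3 : (|ε| * (1 + |s|)) ^ 2 ≤ r ^ 2 := by gcongr
  exact ⟨h1.trans h, by nlinarith, by nlinarith⟩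

/-- The branch of roots of the dispersion relation, as a smooth function of `(s, ε)`. -/
lemma exists_eigenvalue_branch :
    ∃ r₀ : ℝ, 0 < r₀ ∧ r₀ ≤ 1 / 16 ∧ ∃ lam : ℝ → ℝ → ℂ,
      ContDiffOn ℝ ∞ (fun p : ℝ × ℝ => lam p.1 p.2) {p : ℝ × ℝ | |p.2| * (1 + |p.1|) ≤ r₀} ∧
      ∀ s ε : ℝ, |ε| * (1 + |s|) ≤ r₀ → -(1 / 2) < (lam s ε).re ∧
        lam s ε + ((ε ^ 2 * (1 + s ^ 2) : ℝ) : ℂ) * dispR (lam s ε) ((ε * s : ℝ) : ℂ) = 0 := by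
  obtain ⟨ρ, hρ, Λ, hΛ⟩ := exists_dispersion_root
  -- The half of `ρ` gives a strict inequality on the closed region; `1/16` is the range of the
  -- Neumann series.
  have hr0 : 0 < min (ρ / 2) (1 / 16) := by positivity
  let q : ℝ × ℝ → ℂ × ℂ := fun p =>
    (((p.2 ^ 2 * (1 + p.1 ^ 2) : ℝ) : ℂ), ((p.2 * p.1 : ℝ) : ℂ))
  have hq : ∀ p : ℝ × ℝ, |p.2| * (1 + |p.1|) ≤ min (ρ / 2) (1 / 16) → ‖q p‖ < ρ := by
    intro p hp
    obtain ⟨h1, h2, -⟩ := abs_sq_mul_le hr0.le (min_le_right _ _) hp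
    have h3 : min (ρ / 2) (1 / 16) < ρ := (min_le_left _ _).trans_lt (by linarith)
    rw [Prod.norm_def]
    refine max_lt ?_ ?_
    · rw [Complex.norm_real, Real.norm_of_nonneg (by positivity)]
      linarith
    · rw [Complex.norm_real, Real.norm_eq_abs]
      linarith
  refine ⟨min (ρ / 2) (1 / 16), hr0, min_le_right _ _, fun s ε => Λ (q (s, ε)), ?_, ?_⟩
  · intro p hp
    have h1 : ContDiffAt ℝ ∞ Λ (q p) := ((hΛ _ (hq p hp)).1.restrict_scalars ℝ).of_le le_top
    have h3 : ContDiff ℝ ∞ (fun p : ℝ × ℝ => p.2 ^ 2 * (1 + p.1 ^ 2)) := by fun_prop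
    have h4 : ContDiff ℝ ∞ (fun p : ℝ × ℝ => p.2 * p.1) := by fun_prop
    have h2 : ContDiff ℝ ∞ q :=
      (Complex.ofRealCLM.contDiff.comp h3).prodMk (Complex.ofRealCLM.contDiff.comp h4)
    exact (h1.comp p h2.contDiffAt).contDiffWithinAt
  · intro s ε h
    exact (hΛ _ (hq (s, ε) h)).2

/-! ### The Gaussian as a Schwartz function -/

lemma pow_mul_exp_neg_sq_le (m : ℕ) {t : ℝ} (ht : 0 ≤ t) :
    (1 + t) ^ m * Real.exp (-t ^ 2 / 4) ≤ m.factorial * Real.exp 3 := by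
  have h1 : (1 + t) ^ m ≤ m.factorial * Real.exp (1 + t) := by
    have := Real.pow_div_factorial_le_exp (1 + t) (by linarith) m
    rwa [div_le_iff₀ (by positivity), mul_comm] at this
  calc (1 + t) ^ m * Real.exp (-t ^ 2 / 4)
      ≤ m.factorial * Real.exp (1 + t) * Real.exp (-t ^ 2 / 4) := by gcongr
    _ = m.factorial * Real.exp (1 + t + -t ^ 2 / 4) := by rw [mul_assoc, ← Real.exp_add]
    _ ≤ m.factorial * Real.exp 3 := by
        gcongr
        nlinarith [sq_nonneg (t - 2)]

/-- The Gaussian `exp(-|v|²/4)` as a Schwartz function. -/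
def gaussS : 𝓢(V3, ℝ) where
  toFun v := Real.exp (-‖v‖ ^ 2 / 4)
  smooth' := by
    refine Real.contDiff_exp.comp ?_
    exact ((contDiff_norm_sq ℝ).neg).div_const 4
  decay' := by
    intro k n
    have hT : Function.HasTemperateGrowth (fun v : V3 => -‖v‖ ^ 2 / 4) := by
      have h := (Function.hasTemperateGrowth_norm_sq (H := V3)).mul
        (Function.HasTemperateGrowth.const (-1 / 4 : ℝ))
      refine (congrArg Function.HasTemperateGrowth ?_).mp h
      funext v
      simp only [Pi.mul_apply]
      ring
    obtain ⟨l, C, hC, h⟩ := hT.norm_iteratedFDeriv_le_uniform n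
    refine ⟨n.factorial * (max C 1) ^ n * ((l * n + k).factorial * Real.exp 3), fun v => ?_⟩
    -- The bound for iterated derivatives of a composition wants the `i`-th derivative of the
    -- exponent below `D ^ i`; a single polynomially growing `D ≥ 1` serves for all `i ≥ 1`.
    set D : ℝ := max C 1 * (1 + ‖v‖) ^ l with hD
    have hD1 : 1 ≤ D := one_le_mul_of_one_le_of_one_le (le_max_right _ _)
      (one_le_pow₀ (by linarith [norm_nonneg v]))
    have key := norm_iteratedFDeriv_comp_le (𝕜 := ℝ) (g := Real.exp)
      (f := fun v : V3 => -‖v‖ ^ 2 / 4) (n := n) (N := n) (C := Real.exp (-‖v‖ ^ 2 / 4)) (D := D)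
      Real.contDiff_exp (((contDiff_norm_sq ℝ).neg).div_const 4) le_rfl v
      (by
        intro i _
        rw [norm_iteratedFDeriv_eq_norm_iteratedDeriv, iteratedDeriv_eq_iterate,
          Real.iter_deriv_exp, Real.norm_of_nonneg (Real.exp_pos _).le])
      (by
        intro i hi hin
        refine (h i hin v).trans (le_trans ?_ (le_self_pow₀ hD1 (by omega)))
        rw [hD]
        gcongr
        exact le_max_left _ _)
    calc ‖v‖ ^ k * ‖iteratedFDeriv ℝ n (fun v : V3 => Real.exp (-‖v‖ ^ 2 / 4)) v‖
        ≤ (1 + ‖v‖) ^ k * (n.factorial * Real.exp (-‖v‖ ^ 2 / 4) * D ^ n) := by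
          gcongr
          · linarith
          · exact key
      _ = n.factorial * (max C 1) ^ n
            * ((1 + ‖v‖) ^ (l * n + k) * Real.exp (-‖v‖ ^ 2 / 4)) := by
          rw [hD, mul_pow, ← pow_mul, pow_add]; ring
      _ ≤ _ := by
          refine mul_le_mul_of_nonneg_left ?_ (by positivity)
          exact pow_mul_exp_neg_sq_le _ (norm_nonneg v)

/-- `√M` as a Schwartz function. -/
def sqrtMS : 𝓢(V3, ℂ) :=
  ((Real.sqrt ((2 * Real.pi) ^ (-(3 / 2) : ℝ)) : ℝ) : ℂ) •
    SchwartzMap.postcompCLM Complex.ofRealCLM gaussS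

lemma sqrtMS_apply (v : V3) : sqrtMS v = sqrtMFun v := by
  have h : Real.exp (-‖v‖ ^ 2 / 2) = Real.exp (-‖v‖ ^ 2 / 4) ^ 2 := by
    rw [← Real.exp_nat_mul]; congr 1; push_cast; ring
  rw [sqrtMFun, maxwellian, Real.sqrt_mul (by positivity), h, Real.sqrt_sq (Real.exp_pos _).le,
    Complex.ofReal_mul]
  rfl

lemma integral_maxwellian : ∫ v : V3, maxwellian v = 1 := by
  have h := GaussianFourier.integral_rexp_neg_mul_sq_norm (V := V3) (b := 1 / 2) (by norm_num)
  have h2 : (fun v : V3 => maxwellian v)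
      = fun v => (2 * Real.pi) ^ (-(3 / 2) : ℝ) * Real.exp (-(1 / 2) * ‖v‖ ^ 2) := by
    funext v
    rw [maxwellian]
    congr 2
    ring
  rw [h2, integral_const_mul, h, finrank_euclideanSpace_fin]
  have h3 : Real.pi / (1 / 2) = 2 * Real.pi := by ring
  rw [h3, ← Real.rpow_add (by positivity)]
  norm_num

/-! ### Ladder operators on Schwartz functions -/

/-- Multiplication by `v·x`. -/
def mulOp (x : V3) : Module.End ℂ 𝓢(V3, ℂ) :=
  (SchwartzMap.smulLeftCLM ℂ (fun v : V3 => ((inner ℝ v x : ℝ) : ℂ))).toLinearMap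

/-- Derivative in the direction `x`. -/
def derOp (x : V3) : Module.End ℂ 𝓢(V3, ℂ) :=
  (LineDeriv.lineDerivOpCLM ℂ 𝓢(V3, ℂ) x).toLinearMap

lemma hasTemperateGrowth_inner_ofReal (x : V3) :
    Function.HasTemperateGrowth (fun v : V3 => ((inner ℝ v x : ℝ) : ℂ)) :=
  Function.HasTemperateGrowth.comp (g := Complex.ofReal) (f := fun v : V3 => inner ℝ v x)
    Function.Complex.hasTemperateGrowth_ofReal (Function.hasTemperateGrowth_inner_left x)

lemma mulOp_apply (x : V3) (f : 𝓢(V3, ℂ)) (v : V3) :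
    mulOp x f v = ((inner ℝ v x : ℝ) : ℂ) * f v :=
  SchwartzMap.smulLeftCLM_apply_apply (hasTemperateGrowth_inner_ofReal x) f v

lemma derOp_apply (x : V3) (f : 𝓢(V3, ℂ)) (v : V3) : derOp x f v = fderiv ℝ f v x := rfl

lemma mulOp_comm (x y : V3) (f : 𝓢(V3, ℂ)) : mulOp x (mulOp y f) = mulOp y (mulOp x f) := by
  ext v
  simp only [mulOp_apply]
  ring

lemma derOp_comm (x y : V3) (f : 𝓢(V3, ℂ)) : derOp x (derOp y f) = derOp y (derOp x f) := by
  have h : ∀ (x y v : V3), derOp x (derOp y f) v = fderiv ℝ (fderiv ℝ f) v x y := by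
    intro x y v
    have hd : DifferentiableAt ℝ (fderiv ℝ f) v :=
      ((f.smooth 2).fderiv_right (m := 1) (by norm_num)).differentiable (by norm_num) v
    have h1 : (derOp y f : V3 → ℂ) = fun w => fderiv ℝ f w y := rfl
    rw [derOp_apply, h1, fderiv_clm_apply hd (differentiableAt_const y)]
    simp
  ext v
  rw [h, h]
  exact ((f.smooth 2).contDiffAt.isSymmSndFDerivAt (by simp)).eq x y

lemma derOp_mulOp (x y : V3) (f : 𝓢(V3, ℂ)) :
    derOp x (mulOp y f) = mulOp y (derOp x f) + ((inner ℝ x y : ℝ) : ℂ) • f := by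
  ext v
  have h1 : (mulOp y f : V3 → ℂ) = fun w => ((inner ℝ w y : ℝ) : ℂ) * f w :=
    funext (mulOp_apply y f)
  have h2 : HasFDerivAt (fun w : V3 => ((inner ℝ w y : ℝ) : ℂ))
      (Complex.ofRealCLM ∘L (innerSL ℝ).flip y) v :=
    (Complex.ofRealCLM ∘L (innerSL ℝ).flip y).hasFDerivAt
  have h3 := h2.mul (f.differentiable v).hasFDerivAt
  have h4 : (mulOp y (derOp x f) + ((inner ℝ x y : ℝ) : ℂ) • f) v
      = mulOp y (derOp x f) v + ((inner ℝ x y : ℝ) : ℂ) * f v := rfl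
  rw [h4, derOp_apply, h1, mulOp_apply, derOp_apply,
    show (fun w : V3 => ((inner ℝ w y : ℝ) : ℂ) * f w)
      = (fun w : V3 => ((inner ℝ w y : ℝ) : ℂ)) * f from rfl, h3.fderiv]
  have h5 : (innerSL ℝ) y x = inner ℝ x y := real_inner_comm x y
  simp [h5]
  ring

/-- The creation operator `½ v·x - ∂_x`. -/
def cre (x : V3) : Module.End ℂ 𝓢(V3, ℂ) := (1 / 2 : ℂ) • mulOp x - derOp x

/-- The annihilation operator `½ v·x + ∂_x`. -/
def ann (x : V3) : Module.End ℂ 𝓢(V3, ℂ) := (1 / 2 : ℂ) • mulOp x + derOp x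

lemma cre_apply (x : V3) (f : 𝓢(V3, ℂ)) : cre x f = (1 / 2 : ℂ) • mulOp x f - derOp x f := rfl

lemma ann_apply (x : V3) (f : 𝓢(V3, ℂ)) : ann x f = (1 / 2 : ℂ) • mulOp x f + derOp x f := rfl

lemma mulOp_eq_ann_add_cre (x : V3) (f : 𝓢(V3, ℂ)) : mulOp x f = ann x f + cre x f := by
  rw [ann_apply, cre_apply]; module

lemma cre_comm (x y : V3) : Commute (cre x) (cre y) := by
  refine LinearMap.ext fun f => ?_
  change cre x (cre y f) = cre y (cre x f)
  simp only [cre_apply, map_sub, map_smul, mulOp_comm x y, derOp_comm x y, derOp_mulOp,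
    real_inner_comm x y]
  module

lemma ann_cre (x y : V3) (f : 𝓢(V3, ℂ)) :
    ann x (cre y f) = cre y (ann x f) + ((inner ℝ x y : ℝ) : ℂ) • f := by
  simp only [cre_apply, ann_apply, map_sub, map_add, map_smul, mulOp_comm x y, derOp_comm x y,
    derOp_mulOp, real_inner_comm x y]
  module

/-- Summed over an orthonormal basis this is `|v|²/4 - Δ - 3/2 = -L`; each direction contributes one
half of the constant. -/
lemma cre_ann (x : V3) (hx : ‖x‖ = 1) (f : 𝓢(V3, ℂ)) :
    cre x (ann x f) = (1 / 4 : ℂ) • mulOp x (mulOp x f) - derOp x (derOp x f)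
      - (1 / 2 : ℂ) • f := by
  simp only [cre_apply, ann_apply, map_add, map_smul, derOp_mulOp, real_inner_self_eq_norm_sq, hx]
  simp only [one_pow, Complex.ofReal_one]
  module

lemma ann_sqrtMS (x : V3) : ann x sqrtMS = 0 := by
  ext v
  have h0 : ann x sqrtMS v = 1 / 2 * (((inner ℝ v x : ℝ) : ℂ) * sqrtMS v) + fderiv ℝ sqrtMS v x := by
    rw [← mulOp_apply]; rfl
  set c : ℂ := ((Real.sqrt ((2 * Real.pi) ^ (-(3 / 2) : ℝ)) : ℝ) : ℂ) with hc
  have h1 : (sqrtMS : V3 → ℂ) = fun w => c * ((Real.exp (-‖w‖ ^ 2 / 4) : ℝ) : ℂ) := rfl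
  have h2 : HasFDerivAt (fun w : V3 => -‖w‖ ^ 2 / 4) (-(1 / 2 : ℝ) • innerSL ℝ v) v := by
    have h := ((hasStrictFDerivAt_norm_sq v).hasFDerivAt).const_mul (-(1 / 4) : ℝ)
    refine (h.congr_fderiv ?_).congr_of_eventuallyEq (Filter.Eventually.of_forall fun w => ?_)
    · ext w
      simp
      ring
    · simp only
      ring
  have h3 := ((Complex.ofRealCLM.hasFDerivAt.comp v h2.exp).const_mul c).fderiv
  have h4 : (fun w => c * ((Real.exp (-‖w‖ ^ 2 / 4) : ℝ) : ℂ))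
      = fun y => c * (Complex.ofRealCLM ∘ fun x : V3 => Real.exp (-‖x‖ ^ 2 / 4)) y := rfl
  rw [h0, h1, h4, h3]
  simp [real_inner_comm x v]
  ring

/-! ### Hermite functions -/

lemma idx_induction {P : Idx → Prop} (h0 : P 0) (h1 : ∀ α j, P α → P (α + unitIdx j)) (α : Idx) :
    P α := by
  induction hn : deg α generalizing α with
  | zero => rwa [deg_eq_zero.1 hn]
  | succ n ih =>
    have hα : ∃ j, α j ≠ 0 := by
      by_contra! h
      rw [deg_eq_zero.2 (funext h)] at hn
      omega
    obtain ⟨j, hj⟩ := hα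
    rw [← sub_add_unitIdx hj]
    refine h1 _ _ (ih _ ?_)
    have := deg_add_unitIdx (α - unitIdx j) j
    rw [sub_add_unitIdx hj] at this
    omega

variable (b : OrthonormalBasis (Fin 3) ℝ V3)

/-- The (unnormalized) Hermite functions adapted to an orthonormal basis. -/
def herm (α : Idx) : 𝓢(V3, ℂ) :=
  (cre (b 0) ^ α 0 * cre (b 1) ^ α 1 * cre (b 2) ^ α 2) sqrtMS

lemma herm_zero : herm b 0 = sqrtMS := by simp [herm]

lemma cre_herm (j : Fin 3) (α : Idx) : cre (b j) (herm b α) = herm b (α + unitIdx j) := by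
  have hc : ∀ x y : V3, ∀ n : ℕ, cre x * cre y ^ n = cre y ^ n * cre x := fun x y n =>
    ((cre_comm x y).pow_right n).eq
  rw [herm, herm, ← Module.End.mul_apply]
  congr 1
  fin_cases j
  · simp [pow_succ', mul_assoc]
  · simp only [Fin.mk_one, Pi.add_apply, Pi.single_eq_same, pow_succ', Fin.isValue, mul_assoc,
      ne_eq, zero_ne_one, not_false_eq_true, Pi.single_eq_of_ne, add_zero]
    rw [← mul_assoc (cre (b 1)), hc (b 1) (b 0), mul_assoc]
    simp
  · simp only [Pi.add_apply, Fin.reduceFinMk, Pi.single_eq_same, pow_succ', Fin.isValue, mul_assoc]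
    rw [← mul_assoc (cre (b 2)), hc (b 2) (b 0), mul_assoc, ← mul_assoc (cre (b 2)), hc (b 2) (b 1),
      mul_assoc]
    simp

lemma inner_basis (i j : Fin 3) :
    ((inner ℝ (b i) (b j) : ℝ) : ℂ) = if i = j then 1 else 0 := by
  rw [b.inner_eq_ite]; split_ifs <;> simp

/-- The commutation relation `ann_cre` moves the annihilation operator through the creation
operators until it kills `√M`. Truncated subtraction is harmless, since the coefficient vanishes
when `α j = 0`. -/
lemma ann_herm (j : Fin 3) (α : Idx) :
    ann (b j) (herm b α) = (α j : ℂ) • herm b (α - unitIdx j) := by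
  induction α using idx_induction with
  | h0 => rw [herm_zero, ann_sqrtMS]; simp
  | h1 α k ih =>
    rw [← cre_herm, ann_cre, ih, map_smul, cre_herm, inner_basis]
    rcases eq_or_ne j k with rfl | h
    · rw [add_sub_unitIdx, if_pos rfl]
      rcases eq_or_ne (α j) 0 with h0 | h0
      · simp [h0]
      · rw [sub_add_unitIdx h0]
        simp only [Pi.add_apply, Pi.single_eq_same, Nat.cast_add, Nat.cast_one]
        module
    · have h1 : α - unitIdx j + unitIdx k = α + unitIdx k - unitIdx j := by
        funext i
        simp only [Pi.add_apply, Pi.sub_apply]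
        rcases eq_or_ne i j with rfl | hi
        · simp [Pi.single_eq_of_ne h]
        · simp [Pi.single_eq_of_ne hi]
      rw [if_neg h, h1]
      simp [Pi.single_eq_of_ne h]

lemma mulOp_herm (j : Fin 3) (α : Idx) : mulOp (b j) (herm b α)
    = (α j : ℂ) • herm b (α - unitIdx j) + herm b (α + unitIdx j) := by
  rw [mulOp_eq_ann_add_cre, ann_herm, cre_herm]

lemma cre_ann_herm (j : Fin 3) (α : Idx) :
    cre (b j) (ann (b j) (herm b α)) = (α j : ℂ) • herm b α := by
  rw [ann_herm, map_smul, cre_herm]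
  rcases eq_or_ne (α j) 0 with h | h
  · simp [h]
  · rw [sub_add_unitIdx h]

/-! ### Pairings with Schwartz functions -/

/-- The functional `p ↦ ∫ p F`. -/
def pairFn (F : V3 → ℂ) (hF : ∀ p : 𝓢(V3, ℂ), Integrable (fun v => p v * F v)) :
    𝓢(V3, ℂ) →ₗ[ℂ] ℂ where
  toFun p := ∫ v, p v * F v
  map_add' p q := by
    rw [← integral_add (hF p) (hF q)]
    exact integral_congr_ae (Filter.Eventually.of_forall fun v => add_mul _ _ _)
  map_smul' c p := by
    rw [RingHom.id_apply, smul_eq_mul, ← integral_const_mul]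
    exact integral_congr_ae (Filter.Eventually.of_forall fun v => mul_assoc _ _ _)

lemma pairFn_apply (F : V3 → ℂ) (hF : ∀ p : 𝓢(V3, ℂ), Integrable (fun v => p v * F v))
    (p : 𝓢(V3, ℂ)) : pairFn F hF p = ∫ v, p v * F v := rfl

lemma integrable_mul_of_memLp {F : V3 → ℂ} (hF : MemLp F 2) (p : 𝓢(V3, ℂ)) :
    Integrable (fun v => p v * F v) :=
  (p.memLp 2).integrable_mul hF

lemma integrable_mul_schwartz (g p : 𝓢(V3, ℂ)) : Integrable (fun v => p v * g v) :=
  integrable_mul_of_memLp (g.memLp 2) p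

/-- The bilinear pairing `∫ f g`. -/
def pairS (f g : 𝓢(V3, ℂ)) : ℂ := pairFn g (integrable_mul_schwartz g) f

lemma pairS_comm (f g : 𝓢(V3, ℂ)) : pairS f g = pairS g f :=
  integral_congr_ae (Filter.Eventually.of_forall fun _ => mul_comm _ _)

lemma pairS_smul_right (c : ℂ) (f g : 𝓢(V3, ℂ)) : pairS f (c • g) = c * pairS f g := by
  rw [pairS_comm, pairS, map_smul, smul_eq_mul, pairS_comm f g, pairS]

lemma pairS_add_right (f g h : 𝓢(V3, ℂ)) : pairS f (g + h) = pairS f g + pairS f h := by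
  rw [pairS_comm, pairS, map_add, pairS_comm f g, pairS_comm f h, pairS, pairS]

lemma pairS_mulOp (x : V3) (f g : 𝓢(V3, ℂ)) : pairS (mulOp x f) g = pairS f (mulOp x g) := by
  refine integral_congr_ae (Filter.Eventually.of_forall fun v => ?_)
  simp only [mulOp_apply]
  ring

lemma pairS_derOp (x : V3) (f g : 𝓢(V3, ℂ)) : pairS f (derOp x g) = -pairS (derOp x f) g :=
  SchwartzMap.integral_mul_lineDerivOp_right_eq_neg_left f g x

lemma pairS_cre (x : V3) (f g : 𝓢(V3, ℂ)) : pairS (cre x f) g = pairS f (ann x g) := by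
  rw [ann_apply, pairS_add_right, pairS_smul_right, pairS_derOp, ← pairS_mulOp, cre_apply, pairS,
    map_sub, map_smul, smul_eq_mul]
  rfl

/-- The factorial of a multi-index. -/
def idxFactorial (α : Idx) : ℕ := ∏ j, (α j).factorial

lemma idxFactorial_pos (α : Idx) : 0 < idxFactorial α :=
  Finset.prod_pos fun _ _ => Nat.factorial_pos _

lemma idxFactorial_add_unitIdx (α : Idx) (j : Fin 3) :
    idxFactorial (α + unitIdx j) = (α j + 1) * idxFactorial α := by
  rw [idxFactorial, idxFactorial, ← Finset.mul_prod_erase _ _ (Finset.mem_univ j),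
    ← Finset.mul_prod_erase Finset.univ (fun j => (α j).factorial) (Finset.mem_univ j),
    ← mul_assoc]
  congr 1
  · simp [Nat.factorial_succ]
  · refine Finset.prod_congr rfl fun i hi => ?_
    simp [Pi.single_eq_of_ne (Finset.ne_of_mem_erase hi)]

lemma pairS_sqrtMS : pairS sqrtMS sqrtMS = 1 := by
  have h : ∀ v, sqrtMS v * sqrtMS v = ((maxwellian v : ℝ) : ℂ) := by
    intro v
    rw [sqrtMS_apply, sqrtMFun, ← Complex.ofReal_mul, Real.mul_self_sqrt (maxwellian_nonneg v)]
  rw [pairS, pairFn_apply]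
  simp only [h]
  rw [integral_complex_ofReal, integral_maxwellian, Complex.ofReal_one]

/-- Creation and annihilation are transposes of each other, so each creation operator on the left
lowers the index on the right, producing the factorial. -/
lemma pairS_herm (α β : Idx) :
    pairS (herm b α) (herm b β) = if α = β then (idxFactorial α : ℂ) else 0 := by
  induction α using idx_induction generalizing β with
  | h0 =>
    rcases eq_or_ne β 0 with rfl | hβ
    · rw [if_pos rfl, herm_zero, pairS_sqrtMS]
      simp [idxFactorial]
    · obtain ⟨j, hj⟩ := Function.ne_iff.1 hβ
      rw [if_neg hβ.symm, herm_zero, ← sub_add_unitIdx hj, ← cre_herm, pairS_comm, pairS_cre,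
        ann_sqrtMS]
      simpa using pairS_smul_right 0 (herm b (β - unitIdx j)) 0
  | h1 α j ih =>
    rw [← cre_herm, pairS_cre, ann_herm, pairS_smul_right, ih]
    rcases eq_or_ne (β j) 0 with h | h
    · have h1 : α + unitIdx j ≠ β := by
        rintro rfl
        simp at h
      rw [h, if_neg h1, Nat.cast_zero, zero_mul]
    · by_cases h1 : α + unitIdx j = β
      · subst h1
        rw [if_pos rfl, add_sub_unitIdx, if_pos rfl, idxFactorial_add_unitIdx]
        simp
      · rw [if_neg h1, if_neg, mul_zero]
        rintro rfl
        exact h1 (sub_add_unitIdx h)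

/-! ### Completeness of the Hermite functions -/

open scoped FourierTransform in
/-- Injectivity of the Fourier transform on `L¹`. -/
lemma ae_eq_zero_of_fourier_eq_zero {G : V3 → ℂ} (hG : Integrable G) (h : ∀ w, 𝓕 G w = 0) :
    G =ᵐ[volume] 0 := by
  -- Every Schwartz function is the Fourier transform of a Schwartz function, so the transform can
  -- be moved onto `G`.
  have h1 : ∀ ψ : 𝓢(V3, ℂ), ∫ v, ψ v • G v = 0 := by
    intro ψ
    have h2 := VectorFourier.integral_fourierIntegral_smul_eq_flip (L := innerₗ V3)
      (μ := volume) (ν := volume) (f := (𝓕⁻ ψ : 𝓢(V3, ℂ))) (g := G)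
      Real.continuous_fourierChar continuous_inner (𝓕⁻ ψ : 𝓢(V3, ℂ)).integrable hG
    have h3 : ∀ v, VectorFourier.fourierIntegral Real.fourierChar volume (innerₗ V3)
        (𝓕⁻ ψ : 𝓢(V3, ℂ)) v = ψ v := by
      intro v
      have : (𝓕 (𝓕⁻ ψ : 𝓢(V3, ℂ)) : 𝓢(V3, ℂ)) v = ψ v := by
        rw [FourierTransform.fourier_fourierInv_eq]
      rw [← this]
      rfl
    have h4 : ∀ v, VectorFourier.fourierIntegral Real.fourierChar volume (innerₗ V3).flip G v
        = 0 := by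
      intro v
      rw [flip_innerₗ]
      exact h v
    simpa only [h3, h4, smul_zero, integral_zero] using h2
  have hm : MemLp G 1 := memLp_one_iff_integrable.2 hG
  have h5 : hm.toLp G ∈ (Lp.toTemperedDistributionCLM ℂ (volume : Measure V3) 1).ker := by
    rw [LinearMap.mem_ker]
    ext ψ
    change (Lp.toTemperedDistributionCLM ℂ (volume : Measure V3) 1 (hm.toLp G)) ψ = 0
    rw [Lp.toTemperedDistributionCLM_apply, Lp.toTemperedDistribution_apply, ← h1 ψ]
    refine integral_congr_ae ?_
    filter_upwards [hm.coeFn_toLp] with v hv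
    rw [hv]
  rw [Lp.ker_toTemperedDistributionCLM_eq_bot, Submodule.mem_bot] at h5
  exact (hm.coeFn_toLp).symm.trans (by rw [h5]; exact Lp.coeFn_zero _ _ _)

lemma mulOp_mem_span (x : V3) {p : 𝓢(V3, ℂ)} (hp : p ∈ Submodule.span ℂ (Set.range (herm b))) :
    mulOp x p ∈ Submodule.span ℂ (Set.range (herm b)) := by
  have hb : ∀ j, mulOp (b j) p ∈ Submodule.span ℂ (Set.range (herm b)) := by
    intro j
    induction hp using Submodule.span_induction with
    | mem p hp =>
      obtain ⟨α, rfl⟩ := hp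
      rw [mulOp_herm]
      exact Submodule.add_mem _ (Submodule.smul_mem _ _ (Submodule.subset_span ⟨_, rfl⟩))
        (Submodule.subset_span ⟨_, rfl⟩)
    | zero => rw [map_zero]; exact Submodule.zero_mem _
    | add p q _ _ hp hq => rw [map_add]; exact Submodule.add_mem _ hp hq
    | smul c p _ hp => rw [map_smul]; exact Submodule.smul_mem _ _ hp
  have h : mulOp x p = ∑ j, ((inner ℝ (b j) x : ℝ) : ℂ) • mulOp (b j) p := by
    ext v
    rw [mulOp_apply, sum_apply]
    simp only [smul_apply, mulOp_apply, smul_eq_mul, ← mul_assoc]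
    rw [← Finset.sum_mul, ← b.sum_inner_mul_inner v x]
    push_cast
    congr 1
    exact Finset.sum_congr rfl fun j _ => mul_comm _ _
  rw [h]
  exact Submodule.sum_mem _ fun j _ => Submodule.smul_mem _ _ (hb j)

/-- Completeness of the Hermite functions, for functions that may grow. -/
lemma ae_eq_zero_of_pair_herm {F : V3 → ℂ}
    (hF : ∀ p : 𝓢(V3, ℂ), Integrable (fun v => p v * F v))
    (hexp : ∀ r : ℝ, Integrable (fun v : V3 => Real.exp (r * ‖v‖) * ‖sqrtMFun v * F v‖))
    (h0 : ∀ α, ∫ v, herm b α v * F v = 0) : F =ᵐ[volume] 0 := by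
  have hspan : Submodule.span ℂ (Set.range (herm b)) ≤ LinearMap.ker (pairFn F hF) := by
    rw [Submodule.span_le]
    rintro _ ⟨α, rfl⟩
    exact h0 α
  -- The span of the Hermite functions contains `√M` and is stable under multiplication by `v·x`;
  -- hence all directional moments of `√M F` vanish.
  have hpow : ∀ (x : V3) (n : ℕ), ∫ v, ((inner ℝ v x : ℝ) : ℂ) ^ n * (sqrtMFun v * F v) = 0 := by
    intro x n
    have h1 : ∀ n : ℕ, (mulOp x ^ n) sqrtMS ∈ Submodule.span ℂ (Set.range (herm b)) := by
      intro n
      induction n with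
      | zero => exact Submodule.subset_span ⟨0, herm_zero b⟩
      | succ n ih => rw [pow_succ', Module.End.mul_apply]; exact mulOp_mem_span b x ih
    have h2 : ∀ (n : ℕ) (v : V3),
        (mulOp x ^ n) sqrtMS v = ((inner ℝ v x : ℝ) : ℂ) ^ n * sqrtMFun v := by
      intro n v
      induction n with
      | zero => simp [sqrtMS_apply]
      | succ n ih => rw [pow_succ', Module.End.mul_apply, mulOp_apply, ih]; ring
    have h3 : ∫ v, (mulOp x ^ n) sqrtMS v * F v = 0 := hspan (h1 n)
    rw [← h3]
    refine integral_congr_ae (Filter.Eventually.of_forall fun v => ?_)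
    simp only [h2]
    ring
  have hG : Integrable (fun v => sqrtMFun v * F v) := by
    refine (hF sqrtMS).congr (Filter.Eventually.of_forall fun v => ?_)
    simp only [sqrtMS_apply]
  -- Expanding the character in powers of `v·x` reduces to these moments; the exponential
  -- integrability `hexp` dominates the series.
  have hchar : ∀ x : V3, ∫ v, Complex.exp (Complex.I * ((inner ℝ v x : ℝ) : ℂ))
      * (sqrtMFun v * F v) = 0 := by
    intro x
    have hb : ∀ v : V3, HasSum (fun n : ℕ => (‖x‖ * ‖v‖) ^ n / n.factorial * ‖sqrtMFun v * F v‖)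
        (Real.exp (‖x‖ * ‖v‖) * ‖sqrtMFun v * F v‖) := by
      intro v
      have := NormedSpace.expSeries_div_hasSum_exp (‖x‖ * ‖v‖)
      rw [← Real.exp_eq_exp_ℝ] at this
      exact this.mul_right _
    have hs := hasSum_integral_of_dominated_convergence (μ := (volume : Measure V3))
      (F := fun (n : ℕ) (v : V3) => (Complex.I * ((inner ℝ v x : ℝ) : ℂ)) ^ n / n.factorial
        * (sqrtMFun v * F v))
      (f := fun v => Complex.exp (Complex.I * ((inner ℝ v x : ℝ) : ℂ)) * (sqrtMFun v * F v))
      (fun (n : ℕ) (v : V3) => (‖x‖ * ‖v‖) ^ n / n.factorial * ‖sqrtMFun v * F v‖)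
      (fun n => by
        refine AEStronglyMeasurable.mul (Continuous.aestronglyMeasurable ?_) hG.1
        fun_prop)
      (fun n => Filter.Eventually.of_forall fun v => by
        rw [norm_mul, norm_div, norm_pow, norm_mul, Complex.norm_I, one_mul, Complex.norm_natCast,
          Complex.norm_real]
        gcongr
        rw [mul_comm]
        exact norm_inner_le_norm v x)
      (Filter.Eventually.of_forall fun v => (hb v).summable)
      (by
        refine (hexp ‖x‖).congr (Filter.Eventually.of_forall fun v => ?_)
        exact (hb v).tsum_eq.symm)
      (Filter.Eventually.of_forall fun v => by
        have := NormedSpace.expSeries_div_hasSum_exp (Complex.I * ((inner ℝ v x : ℝ) : ℂ))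
        rw [← Complex.exp_eq_exp_ℂ] at this
        exact this.mul_right _)
    refine hs.unique ?_
    convert hasSum_zero using 1
    funext n
    have : (fun v => (Complex.I * ((inner ℝ v x : ℝ) : ℂ)) ^ n / n.factorial
        * (sqrtMFun v * F v)) = fun v => Complex.I ^ n / n.factorial
          * (((inner ℝ v x : ℝ) : ℂ) ^ n * (sqrtMFun v * F v)) := by
      funext v
      rw [mul_pow]
      ring
    rw [this, integral_const_mul, hpow, mul_zero]
  have hz := ae_eq_zero_of_fourier_eq_zero hG (by
    intro w
    rw [Real.fourier_eq', ← hchar (-(2 * Real.pi) • w)]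
    refine integral_congr_ae (Filter.Eventually.of_forall fun v => ?_)
    simp only [smul_eq_mul, inner_smul_right]
    congr 2
    push_cast
    ring)
  filter_upwards [hz] with v hv
  have hne : sqrtMFun v ≠ 0 := by
    have : 0 < ‖sqrtMFun v‖ ^ 2 := by
      rw [norm_sqrtMFun_sq, maxwellian]
      positivity
    intro h
    simp [h] at this
  exact (mul_eq_zero.1 hv).resolve_left hne

lemma memLp_exp_mul_sqrtMFun (r : ℝ) :
    MemLp (fun v : V3 => ((Real.exp (r * ‖v‖) : ℝ) : ℂ) * sqrtMFun v) 2 := by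
  have hc : Continuous (fun v : V3 => ((Real.exp (r * ‖v‖) : ℝ) : ℂ) * sqrtMFun v) :=
    (Complex.continuous_ofReal.comp (by fun_prop)).mul continuous_sqrtMFun
  refine (memLp_two_iff_integrable_sq_norm hc.aestronglyMeasurable).2 ?_
  refine ((integrable_gauss (b := 1 / 4) (by norm_num)).const_mul
    ((2 * Real.pi) ^ (-(3 / 2) : ℝ) * Real.exp (4 * r ^ 2))).mono'
    (hc.norm.pow 2).aestronglyMeasurable (Filter.Eventually.of_forall fun v => ?_)
  rw [Real.norm_of_nonneg (by positivity), norm_mul, mul_pow, norm_sqrtMFun_sq, Complex.norm_real,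
    Real.norm_of_nonneg (Real.exp_pos _).le, maxwellian, ← Real.exp_nat_mul]
  calc _ = (2 * Real.pi) ^ (-(3 / 2) : ℝ)
        * Real.exp (((2 : ℕ) : ℝ) * (r * ‖v‖) + -‖v‖ ^ 2 / 2) := by rw [Real.exp_add]; ring
    _ ≤ (2 * Real.pi) ^ (-(3 / 2) : ℝ) * Real.exp (4 * r ^ 2 + -(1 / 4) * ‖v‖ ^ 2) := by
        refine mul_le_mul_of_nonneg_left (Real.exp_le_exp.2 ?_) (by positivity)
        push_cast
        nlinarith [sq_nonneg (‖v‖ / 2 - 2 * r)]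
    _ = _ := by rw [Real.exp_add]; ring

lemma integrable_exp_mul_of_memLp {F : V3 → ℂ} (hF : MemLp F 2) (r : ℝ) :
    Integrable (fun v : V3 => Real.exp (r * ‖v‖) * ‖sqrtMFun v * F v‖) := by
  have h := ((memLp_exp_mul_sqrtMFun r).integrable_mul hF).norm
  refine h.congr (Filter.Eventually.of_forall fun v => ?_)
  simp only [Pi.mul_apply]
  rw [norm_mul, norm_mul, Complex.norm_real, Real.norm_of_nonneg (Real.exp_pos _).le, norm_mul,
    mul_assoc]

/-! ### The Hermite basis of `L²` -/

/-- The norm of a Hermite function. -/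
def hermNorm (α : Idx) : ℝ := Real.sqrt (idxFactorial α)

lemma hermNorm_pos (α : Idx) : 0 < hermNorm α :=
  Real.sqrt_pos.2 (by exact_mod_cast idxFactorial_pos α)

lemma hermNorm_ne_zero (α : Idx) : (hermNorm α : ℂ) ≠ 0 :=
  Complex.ofReal_ne_zero.2 (hermNorm_pos α).ne'

lemma hermNorm_add_unitIdx (α : Idx) (j : Fin 3) :
    hermNorm (α + unitIdx j) = Real.sqrt (α j + 1) * hermNorm α := by
  rw [hermNorm, hermNorm, idxFactorial_add_unitIdx]
  push_cast
  rw [Real.sqrt_mul (by positivity)]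

lemma star_mulOp_apply (x : V3) {f : 𝓢(V3, ℂ)} (hf : ∀ v, star (f v) = f v) (v : V3) :
    star (mulOp x f v) = mulOp x f v := by
  rw [mulOp_apply, star_mul', hf]
  simp

lemma star_derOp_apply (x : V3) {f : 𝓢(V3, ℂ)} (hf : ∀ v, star (f v) = f v) (v : V3) :
    star (derOp x f v) = derOp x f v := by
  have h : HasFDerivAt (fun w => star (f w))
      ((Complex.conjCLE : ℂ →L[ℝ] ℂ) ∘L fderiv ℝ f v) v :=
    (Complex.conjCLE : ℂ →L[ℝ] ℂ).hasFDerivAt.comp v (f.differentiable v).hasFDerivAt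
  have h2 : (fun w => star (f w)) = f := funext hf
  rw [h2] at h
  rw [derOp_apply]
  nth_rw 2 [h.fderiv]
  rfl

/-- Hermite functions are real. Therefore the inner product with them is the bilinear pairing, and
complex conjugation acts coefficientwise. -/
lemma star_herm_apply (α : Idx) (v : V3) : star (herm b α v) = herm b α v := by
  induction α using idx_induction generalizing v with
  | h0 =>
    rw [herm_zero, sqrtMS_apply, sqrtMFun]
    simp
  | h1 α j ih =>
    have h : cre (b j) (herm b α) v
        = 1 / 2 * mulOp (b j) (herm b α) v - derOp (b j) (herm b α) v := rfl
    rw [← cre_herm, h, star_sub, star_mul', star_mulOp_apply _ ih, star_derOp_apply _ ih]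
    simp

/-- The normalized Hermite functions in `L²`. -/
def hermL2 (α : Idx) : L2 := ((hermNorm α : ℂ)⁻¹) • ((herm b α).toLp 2 volume : L2)

lemma inner_toLp_herm (α : Idx) (f : L2) :
    inner ℂ ((herm b α).toLp 2) f = ∫ v, herm b α v * f v := by
  rw [MeasureTheory.L2.inner_def]
  refine integral_congr_ae ?_
  filter_upwards [(herm b α).coeFn_toLp 2] with v hv
  rw [hv, RCLike.inner_apply, ← Complex.star_def, star_herm_apply, mul_comm]

lemma inner_hermL2 (α : Idx) (f : L2) :
    inner ℂ (hermL2 b α) f = (hermNorm α : ℂ)⁻¹ * ∫ v, herm b α v * f v := by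
  rw [hermL2, inner_smul_left, inner_toLp_herm, map_inv₀, Complex.conj_ofReal]

lemma orthonormal_hermL2 : Orthonormal ℂ (hermL2 b) := by
  rw [orthonormal_iff_ite]
  intro α β
  have h1 : ∫ v, herm b α v * hermL2 b β v = (hermNorm β : ℂ)⁻¹ * pairS (herm b α) (herm b β) := by
    rw [← pairS_smul_right]
    refine integral_congr_ae ?_
    filter_upwards [(herm b β).coeFn_toLp 2,
      Lp.coeFn_smul ((hermNorm β : ℂ)⁻¹) ((herm b β).toLp 2)] with v h1 h2
    rw [hermL2, h2, Pi.smul_apply, h1]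
    rfl
  rw [inner_hermL2, h1, pairS_herm]
  split_ifs with h
  · subst h
    have h2 : ((idxFactorial α : ℕ) : ℂ) = hermNorm α * hermNorm α := by
      rw [← Complex.ofReal_mul, hermNorm, Real.mul_self_sqrt (by positivity), Complex.ofReal_natCast]
    rw [h2]
    field_simp [hermNorm_ne_zero α]
  · simp

lemma orthogonal_span_hermL2 : (Submodule.span ℂ (Set.range (hermL2 b)))ᗮ = ⊥ := by
  rw [Submodule.eq_bot_iff]
  intro f hf
  have h0 : ∀ α, ∫ v, herm b α v * f v = 0 := by
    intro α
    have h1 : inner ℂ (hermL2 b α) f = 0 := hf _ (Submodule.subset_span ⟨α, rfl⟩)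
    rw [inner_hermL2] at h1
    exact (mul_eq_zero.1 h1).resolve_left (inv_ne_zero (hermNorm_ne_zero α))
  have := ae_eq_zero_of_pair_herm b (fun p => integrable_mul_of_memLp (Lp.memLp f) p)
    (fun r => integrable_exp_mul_of_memLp (Lp.memLp f) r) h0
  exact Lp.ext (this.trans (Lp.coeFn_zero _ _ _).symm)

/-- The Hermite basis of `L²(ℝ³)` adapted to an orthonormal basis of `ℝ³`. -/
def hermBasis : HilbertBasis Idx ℂ L2 :=
  HilbertBasis.mkOfOrthogonalEqBot (orthonormal_hermL2 b) (orthogonal_span_hermL2 b)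

lemma hermBasis_apply (α : Idx) : hermBasis b α = hermL2 b α := by
  rw [hermBasis, HilbertBasis.coe_mkOfOrthogonalEqBot]

/-- The unitary map to Hermite coefficients. -/
def coef : L2 ≃ₗᵢ[ℂ] Ell := (hermBasis b).repr

lemma coef_apply (f : L2) (α : Idx) :
    coef b f α = (hermNorm α : ℂ)⁻¹ * ∫ v, herm b α v * f v := by
  rw [coef, HilbertBasis.repr_apply_apply, hermBasis_apply, inner_hermL2]

lemma integral_herm_mul (f : L2) (α : Idx) :
    ∫ v, herm b α v * f v = hermNorm α * coef b f α := by
  rw [coef_apply, mul_inv_cancel_left₀ (hermNorm_ne_zero α)]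

lemma coef_hermL2 (α : Idx) : coef b (hermL2 b α) = dirac α := by
  rw [coef, ← hermBasis_apply]
  exact (hermBasis b).repr_self α

lemma sqrtM_eq_toLp : sqrtM = sqrtMS.toLp 2 := by
  refine Lp.ext ?_
  filter_upwards [memLp_sqrtMFun.coeFn_toLp, sqrtMS.coeFn_toLp 2] with v h1 h2
  rw [sqrtM, h1, h2, sqrtMS_apply]

lemma coef_sqrtM : coef b sqrtM = dirac 0 := by
  have h : hermNorm 0 = 1 := by simp [hermNorm, idxFactorial]
  rw [← coef_hermL2 b, hermL2, h, herm_zero, sqrtM_eq_toLp]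
  simp

lemma coef_vSqrtM (j : Fin 3) : coef b (vSqrtM (b j)) = dirac (unitIdx j) := by
  have h : hermNorm (unitIdx j) = 1 := by
    have := hermNorm_add_unitIdx 0 j
    simpa [hermNorm, idxFactorial] using this
  have h2 : herm b (unitIdx j) = mulOp (b j) sqrtMS := by
    have := mulOp_herm b j 0
    rw [herm_zero] at this
    simp [this]
  rw [← coef_hermL2 b, hermL2, h, h2]
  congr 1
  rw [Complex.ofReal_one, inv_one, one_smul]
  refine Lp.ext ?_
  filter_upwards [(memLp_mul_sqrtMFun (b j)).coeFn_toLp, (mulOp (b j) sqrtMS).coeFn_toLp 2]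
    with v h1 h2
  rw [vSqrtM, h1, h2, mulOp_apply, sqrtMS_apply]

lemma coef_star (f : L2) (α : Idx) : coef b (star f) α = star (coef b f α) := by
  have h : ∫ v, herm b α v * (star f : L2) v = star (∫ v, herm b α v * f v) := by
    rw [Complex.star_def, ← integral_conj]
    refine integral_congr_ae ?_
    filter_upwards [Lp.coeFn_star f] with v hv
    rw [hv, map_mul, ← Complex.star_def, star_herm_apply, Pi.star_apply]
  rw [coef_apply, coef_apply, h, star_mul']
  simp

/-! ### The operators in Hermite coefficients -/

/-- The action of `L` on Schwartz functions. -/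
def hamS (f : 𝓢(V3, ℂ)) : 𝓢(V3, ℂ) := -∑ j, cre (b j) (ann (b j) f)

open scoped LineDeriv in
-- Both terms of `L` are their own transposes, so `L` passes to the test function, where it factors
-- through the ladder operators by `cre_ann`.
lemma distL_apply (T : 𝓢'(V3, ℂ)) (f : 𝓢(V3, ℂ)) : distL T f = T (hamS b f) := by
  have h1 : distL T f = T (Δ f)
      - T (SchwartzMap.smulLeftCLM ℂ (fun v : V3 => ((‖v‖ ^ 2 / 4 : ℝ) : ℂ)) f)
      + (3 / 2 : ℂ) * T f := by
    rw [← TemperedDistribution.laplacian_apply_apply,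
      ← TemperedDistribution.smulLeftCLM_apply_apply, ← TemperedDistribution.laplacianCLM_apply]
    rfl
  have h2 : SchwartzMap.smulLeftCLM ℂ (fun v : V3 => ((‖v‖ ^ 2 / 4 : ℝ) : ℂ)) f
      = (1 / 4 : ℂ) • ∑ j, mulOp (b j) (mulOp (b j) f) := by
    have ht : Function.HasTemperateGrowth (fun v : V3 => ((‖v‖ ^ 2 / 4 : ℝ) : ℂ)) := by
      refine Function.HasTemperateGrowth.comp (g := Complex.ofReal)
        (f := fun v : V3 => ‖v‖ ^ 2 / 4) Function.Complex.hasTemperateGrowth_ofReal ?_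
      have h := (Function.hasTemperateGrowth_norm_sq (H := V3)).mul
        (Function.HasTemperateGrowth.const (1 / 4 : ℝ))
      refine (congrArg Function.HasTemperateGrowth ?_).mp h
      funext v
      simp only [Pi.mul_apply]
      ring
    ext v
    rw [SchwartzMap.smulLeftCLM_apply_apply ht, smul_apply, sum_apply]
    simp only [mulOp_apply, smul_eq_mul, ← mul_assoc]
    rw [← b.sum_sq_inner_left v, ← Finset.sum_mul]
    push_cast
    simp only [← pow_two]
    ring
  have h3 : Δ f = ∑ j, derOp (b j) (derOp (b j) f) := SchwartzMap.laplacian_eq_sum b f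
  have h4 : hamS b f = Δ f
      - SchwartzMap.smulLeftCLM ℂ (fun v : V3 => ((‖v‖ ^ 2 / 4 : ℝ) : ℂ)) f
      + (3 / 2 : ℂ) • f := by
    rw [h2, h3, hamS]
    simp only [cre_ann _ (b.norm_eq_one _), Fin.sum_univ_three]
    module
  rw [h1, h4, map_add, map_sub, map_smul, smul_eq_mul]

lemma hamS_herm (α : Idx) : hamS b (herm b α) = -(deg α : ℂ) • herm b α := by
  rw [hamS]
  simp only [cre_ann_herm, ← Finset.sum_smul]
  rw [deg, ← neg_smul]
  push_cast
  rfl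

lemma pairS_hamS (f g : 𝓢(V3, ℂ)) : pairS (hamS b f) g = pairS f (hamS b g) := by
  have h : ∀ f g : 𝓢(V3, ℂ), pairS (hamS b f) g = -∑ j, pairS (ann (b j) f) (ann (b j) g) := by
    intro f g
    rw [hamS, pairS, map_neg, map_sum]
    congr 1
    exact Finset.sum_congr rfl fun j _ => pairS_cre _ _ _
  rw [h, pairS_comm f, h]
  congr 1
  exact Finset.sum_congr rfl fun j _ => pairS_comm _ _

lemma toDist_apply (f : L2) (p : 𝓢(V3, ℂ)) : toDist f p = ∫ v, p v * f v := by
  rw [toDist, Lp.toTemperedDistributionCLM_apply, Lp.toTemperedDistribution_apply]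
  rfl

lemma hermL2_mem_graphL (α : Idx) : (hermL2 b α, -(deg α : ℂ) • hermL2 b α) ∈ graphL := by
  change distL (toDist (hermL2 b α)) = toDist (-(deg α : ℂ) • hermL2 b α)
  rw [map_smul, hermL2, map_smul, map_smul, smul_comm]
  congr 1
  ext p
  have h : ∀ q : 𝓢(V3, ℂ), toDist ((herm b α).toLp 2) q = pairS q (herm b α) := by
    intro q
    rw [toDist_apply]
    refine integral_congr_ae ?_
    filter_upwards [(herm b α).coeFn_toLp 2] with v hv
    rw [hv]
  have h2 : (-(deg α : ℂ) • toDist ((herm b α).toLp 2)) p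
      = -(deg α : ℂ) * toDist ((herm b α).toLp 2) p := rfl
  rw [distL_apply b, h2, h, h, pairS_hamS, hamS_herm, pairS_smul_right]

/-- Forward: test against Hermite functions. Backward: finite Hermite sums lie in the graph, which
is closed because the equation is continuous into tempered distributions. -/
lemma mem_graphL_iff (f g : L2) :
    (f, g) ∈ graphL ↔ ∀ α, coef b g α = -(deg α : ℂ) * coef b f α := by
  constructor
  · intro h α
    have h1 : distL (toDist f) = toDist g := h
    have h2 : toDist f (hamS b (herm b α)) = toDist g (herm b α) := by
      rw [← distL_apply, h1]
    rw [hamS_herm, map_smul, toDist_apply, toDist_apply, integral_herm_mul, integral_herm_mul,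
      smul_eq_mul] at h2
    refine mul_left_cancel₀ (hermNorm_ne_zero α) ?_
    rw [← h2]
    ring
  · intro h
    have h1 : HasSum (fun α => coef b f α • hermL2 b α) f := by
      have := (hermBasis b).hasSum_repr f
      simp only [hermBasis_apply] at this
      exact this
    have h2 : HasSum (fun α => coef b g α • hermL2 b α) g := by
      have := (hermBasis b).hasSum_repr g
      simp only [hermBasis_apply] at this
      exact this
    have h3 : IsClosed (graphL : Set (L2 × L2)) :=
      isClosed_eq (distL.continuous.comp (toDist.continuous.comp continuous_fst))
        (toDist.continuous.comp continuous_snd)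
    have h4 := h1.prodMk h2
    refine h3.mem_of_tendsto h4 (Filter.Eventually.of_forall fun s => ?_)
    refine Submodule.sum_mem _ fun α _ => ?_
    have := graphL.smul_mem (coef b f α) (hermL2_mem_graphL b α)
    rw [Prod.smul_mk, smul_smul] at this
    rwa [h, mul_comm]

lemma integral_herm_mul_inner (f : L2) (j : Fin 3) (α : Idx) :
    ∫ v, herm b α v * (((inner ℝ v (b j) : ℝ) : ℂ) * f v)
      = hermNorm α * (((Real.sqrt (α j) : ℝ) : ℂ) * coef b f (α - unitIdx j)
        + ((Real.sqrt (α j + 1) : ℝ) : ℂ) * coef b f (α + unitIdx j)) := by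
  have h1 : ∫ v, herm b α v * (((inner ℝ v (b j) : ℝ) : ℂ) * f v)
      = pairFn f (integrable_mul_of_memLp (Lp.memLp f)) (mulOp (b j) (herm b α)) := by
    refine integral_congr_ae (Filter.Eventually.of_forall fun v => ?_)
    simp only [mulOp_apply]
    ring
  rw [h1, mulOp_herm, map_add, map_smul, pairFn_apply, pairFn_apply, integral_herm_mul,
    integral_herm_mul, hermNorm_add_unitIdx, smul_eq_mul]
  rcases eq_or_ne (α j) 0 with h | h
  · simp [h]
  · have h2 := hermNorm_add_unitIdx (α - unitIdx j) j
    have h3 : (((α - unitIdx j) j : ℕ) : ℝ) + 1 = α j := by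
      have : (α - unitIdx j) j + 1 = α j := by
        simp only [Pi.sub_apply, Pi.single_eq_same]; omega
      exact_mod_cast this
    rw [sub_add_unitIdx h, h3] at h2
    have h4 : (α j : ℂ) = ((Real.sqrt (α j) : ℝ) : ℂ) * ((Real.sqrt (α j) : ℝ) : ℂ) := by
      rw [← Complex.ofReal_mul, Real.mul_self_sqrt (by positivity), Complex.ofReal_natCast]
    rw [h2, h4]
    push_cast
    ring

/-- In the backward direction `(v·ξ) f` is not yet known to be in `L²`, so completeness is needed
for functions with growth, which `ae_eq_zero_of_pair_herm` provides. -/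
lemma mem_graphMul_iff (f g : L2) (s : ℝ) (j : Fin 3) :
    (f, g) ∈ graphMul (s • b j) ↔ ∀ α, coef b g α
      = s * (((Real.sqrt (α j) : ℝ) : ℂ) * coef b f (α - unitIdx j)
        + ((Real.sqrt (α j + 1) : ℝ) : ℂ) * coef b f (α + unitIdx j)) := by
  have hmem : (f, g) ∈ graphMul (s • b j)
      ↔ g =ᵐ[volume] fun v => ((inner ℝ v (s • b j) : ℝ) : ℂ) * f v := Iff.rfl
  have hs : ∀ v, ((inner ℝ v (s • b j) : ℝ) : ℂ) * f v
      = s * (((inner ℝ v (b j) : ℝ) : ℂ) * f v) := by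
    intro v
    rw [inner_smul_right]
    push_cast
    ring
  have hint : ∀ α, ∫ v, herm b α v * (((inner ℝ v (s • b j) : ℝ) : ℂ) * f v)
      = hermNorm α * (s * (((Real.sqrt (α j) : ℝ) : ℂ) * coef b f (α - unitIdx j)
        + ((Real.sqrt (α j + 1) : ℝ) : ℂ) * coef b f (α + unitIdx j))) := by
    intro α
    rw [mul_left_comm, ← integral_herm_mul_inner, ← integral_const_mul]
    refine integral_congr_ae (Filter.Eventually.of_forall fun v => ?_)
    simp only [hs]
    ring
  rw [hmem]
  constructor
  · intro h α
    refine mul_left_cancel₀ (hermNorm_ne_zero α) ?_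
    rw [← hint, ← integral_herm_mul]
    refine integral_congr_ae ?_
    filter_upwards [h] with v hv
    rw [hv]
  · intro h
    have hp : ∀ p : 𝓢(V3, ℂ), Integrable
        (fun v => p v * (((inner ℝ v (s • b j) : ℝ) : ℂ) * f v)) := by
      intro p
      refine (integrable_mul_of_memLp (Lp.memLp f) (mulOp (s • b j) p)).congr
        (Filter.Eventually.of_forall fun v => ?_)
      simp only [mulOp_apply]
      ring
    have hz : (fun v => g v - ((inner ℝ v (s • b j) : ℝ) : ℂ) * f v) =ᵐ[volume] 0 := by
      refine ae_eq_zero_of_pair_herm b (fun p => ?_) (fun r => ?_) (fun α => ?_)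
      · refine ((integrable_mul_of_memLp (Lp.memLp g) p).sub (hp p)).congr
          (Filter.Eventually.of_forall fun v => ?_)
        simp only [Pi.sub_apply]
        ring
      · refine ((integrable_exp_mul_of_memLp (Lp.memLp g) r).add
          ((integrable_exp_mul_of_memLp (Lp.memLp f) (r + 1)).const_mul ‖s • b j‖)).mono' ?_
          (Filter.Eventually.of_forall fun v => ?_)
        · have hc : Continuous fun v : V3 => ((inner ℝ v (s • b j) : ℝ) : ℂ) :=
            Complex.continuous_ofReal.comp (by fun_prop)
          refine AEStronglyMeasurable.mul (Continuous.aestronglyMeasurable (by fun_prop)) ?_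
          exact (continuous_sqrtMFun.aestronglyMeasurable.mul
            ((Lp.aestronglyMeasurable g).sub
              (hc.aestronglyMeasurable.mul (Lp.aestronglyMeasurable f)))).norm
        · rw [Real.norm_of_nonneg (by positivity), Pi.add_apply]
          have h1 : ‖((inner ℝ v (s • b j) : ℝ) : ℂ)‖ ≤ Real.exp ‖v‖ * ‖s • b j‖ := by
            rw [Complex.norm_real]
            refine (norm_inner_le_norm v _).trans ?_
            gcongr
            linarith [Real.add_one_le_exp ‖v‖]
          have h2 : Real.exp ((r + 1) * ‖v‖) = Real.exp (r * ‖v‖) * Real.exp ‖v‖ := by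
            rw [← Real.exp_add]; congr 1; ring
          rw [h2]
          calc Real.exp (r * ‖v‖) * ‖sqrtMFun v * (g v - ((inner ℝ v (s • b j) : ℝ) : ℂ) * f v)‖
              ≤ Real.exp (r * ‖v‖) * (‖sqrtMFun v * g v‖
                + ‖((inner ℝ v (s • b j) : ℝ) : ℂ)‖ * ‖sqrtMFun v * f v‖) := by
                gcongr
                rw [mul_sub, mul_left_comm, ← norm_mul]
                exact norm_sub_le _ _
            _ ≤ Real.exp (r * ‖v‖) * (‖sqrtMFun v * g v‖
                + (Real.exp ‖v‖ * ‖s • b j‖) * ‖sqrtMFun v * f v‖) := by gcongr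
            _ = _ := by ring
      · have : (fun v => herm b α v * (g v - ((inner ℝ v (s • b j) : ℝ) : ℂ) * f v))
            = fun v => herm b α v * g v
              - herm b α v * (((inner ℝ v (s • b j) : ℝ) : ℂ) * f v) := by
          funext v; ring
        rw [this, integral_sub (integrable_mul_of_memLp (Lp.memLp g) _) (hp _), hint,
          integral_herm_mul, h, sub_self]
    filter_upwards [hz] with v hv
    exact sub_eq_zero.1 hv

lemma P0_apply (f : L2) : P0 f = (inner ℂ sqrtM f : ℂ) • sqrtM := rfl

lemma mem_domain_opL_iff (f g : L2) :
    (∃ h : f ∈ opL.domain, opL ⟨f, h⟩ = g) ↔ (f, g) ∈ graphL := by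
  rw [← graph_opL, LinearPMap.mem_graph_iff]
  constructor
  · rintro ⟨h, e⟩
    exact ⟨⟨f, h⟩, rfl, e⟩
  · rintro ⟨⟨y, hy⟩, rfl, e⟩
    exact ⟨hy, e⟩

lemma mem_domain_opMul_iff (ξ : V3) (f g : L2) :
    (∃ h : f ∈ (opMul ξ).domain, opMul ξ ⟨f, h⟩ = g) ↔ (f, g) ∈ graphMul ξ := by
  rw [← graph_opMul, LinearPMap.mem_graph_iff]
  constructor
  · rintro ⟨h, e⟩
    exact ⟨⟨f, h⟩, rfl, e⟩
  · rintro ⟨⟨y, hy⟩, rfl, e⟩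
    exact ⟨hy, e⟩

lemma opMul_P0 (ξ : V3) (f : L2) :
    opMul ξ ⟨P0 f, P0_mem_domain ξ f⟩ = (inner ℂ sqrtM f : ℂ) • vSqrtM ξ := by
  have h := (graphMul ξ).smul_mem (inner ℂ sqrtM f : ℂ) (sqrtM_mem_graphMul ξ)
  obtain ⟨_, h2⟩ := (mem_domain_opMul_iff ξ _ _).2 h
  exact h2

lemma mem_domain_opB_iff (ε : ℝ) (ξ : V3) (f g : L2) :
    (∃ h : f ∈ (opB ε ξ).domain, opB ε ξ ⟨f, h⟩ = g) ↔
      ∃ g₁ g₂, (f, g₁) ∈ graphL ∧ (f, g₂) ∈ graphMul ξ ∧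
        g = g₁ - (Complex.I * ε) • g₂ - (Complex.I * ε * ((‖ξ‖ ^ 2 : ℝ) : ℂ)⁻¹) •
          ((inner ℂ sqrtM f : ℂ) • vSqrtM ξ) := by
  constructor
  · rintro ⟨h, rfl⟩
    refine ⟨opL ⟨f, h.1.1⟩, opMul ξ ⟨f, h.1.2⟩, (mem_domain_opL_iff _ _).1 ⟨h.1.1, rfl⟩,
      (mem_domain_opMul_iff _ _ _).1 ⟨h.1.2, rfl⟩, ?_⟩
    rw [← opMul_P0]
    rfl
  · rintro ⟨g₁, g₂, h1, h2, rfl⟩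
    obtain ⟨d1, rfl⟩ := (mem_domain_opL_iff _ _).2 h1
    obtain ⟨d2, rfl⟩ := (mem_domain_opMul_iff _ _ _).2 h2
    refine ⟨⟨⟨d1, d2⟩, trivial⟩, ?_⟩
    rw [← opMul_P0]
    rfl

lemma inner_sqrtM (f : L2) : inner ℂ sqrtM f = coef b f 0 := by
  have h : sqrtM = hermBasis b 0 := by
    rw [hermBasis_apply]
    exact (coef b).injective (by rw [coef_sqrtM, coef_hermL2])
  rw [h, coef, HilbertBasis.repr_apply_apply]

lemma coef_P0 (f : L2) : coef b (P0 f) = coef b f 0 • dirac 0 := by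
  rw [P0_apply, map_smul, coef_sqrtM, inner_sqrtM b]

lemma coef_P1 (f : L2) : coef b (P1 f) = coef b f - coef b f 0 • dirac 0 := by
  rw [← coef_P0, ← map_sub]
  rfl

lemma vSqrtM_smul (s : ℝ) (x : V3) : vSqrtM (s • x) = (s : ℂ) • vSqrtM x := by
  refine Lp.ext ?_
  filter_upwards [(memLp_mul_sqrtMFun (s • x)).coeFn_toLp, (memLp_mul_sqrtMFun x).coeFn_toLp,
    Lp.coeFn_smul (s : ℂ) (vSqrtM x)] with v h1 h2 h3
  rw [h3, Pi.smul_apply, vSqrtM, vSqrtM, h1, h2, inner_smul_right, smul_eq_mul]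
  push_cast
  ring

lemma opT_eq_add (z a c : ℂ) (u : Ell) : opT z a c u = z • opS u + opT 0 a c u := by
  simp only [opT, zero_smul, add_zero, add_apply, smul_apply]
  abel

lemma opS_apply_sub (u : Ell) (α : Idx) :
    ((Real.sqrt (α 0) : ℝ) : ℂ) * opS u (α - unitIdx 0) = wDown α * u (α - unitIdx 0) := by
  rcases eq_or_ne (α 0) 0 with h | h
  · simp [h, wDown]
  · have h2 : (1 + deg (α - unitIdx 0) : ℝ) = deg α := by
      have := deg_add_unitIdx (α - unitIdx 0) 0
      rw [sub_add_unitIdx h] at this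
      rw [this]
      push_cast
      ring
    rw [opS_apply, h2, wDown, ← mul_assoc]
    push_cast
    rfl

lemma opS_apply_add (u : Ell) (α : Idx) :
    ((Real.sqrt (α 0 + 1) : ℝ) : ℂ) * opS u (α + unitIdx 0) = wUp α * u (α + unitIdx 0) := by
  have h2 : (1 + deg (α + unitIdx 0) : ℝ) = 2 + deg α := by
    rw [deg_add_unitIdx]
    push_cast
    ring
  rw [opS_apply, h2, wUp, ← mul_assoc]
  push_cast
  rfl

lemma opS_apply_zero (u : Ell) : opS u 0 = u 0 := by
  rw [opS_apply, deg_zero]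
  simp

/-- `B_ε(ξ)` in Hermite coefficients. -/
lemma opB_iff {ε s : ℝ} (hs : 0 < s) (f g : L2) :
    (∃ h : f ∈ (opB ε (s • b 0)).domain, opB ε (s • b 0) ⟨f, h⟩ = g) ↔
      ∃ u : Ell, coef b f = opS u
        ∧ coef b g = -opT 0 ((ε * s : ℝ) : ℂ) ((ε / s : ℝ) : ℂ) u := by
  have hn : ‖s • b 0‖ = s := by
    rw [norm_smul, b.norm_eq_one, Real.norm_of_nonneg hs.le, mul_one]
  have hsC : (s : ℂ) ≠ 0 := Complex.ofReal_ne_zero.2 hs.ne'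
  have hdeg : ∀ α, (1 + deg α : ℂ) ≠ 0 := fun α => by
    have : ((1 + deg α : ℕ) : ℂ) ≠ 0 := Nat.cast_ne_zero.2 (by omega)
    simpa using this
  have hS : ∀ (u : Ell) (α : Idx), opS u α - u α = -(deg α : ℂ) * opS u α := by
    intro u α
    rw [opS_apply]
    push_cast
    have := hdeg α
    field_simp
    ring
  have hfin : ∀ (u g₁ g₂ : Ell), g₁ = opS u - u → g₂ = (s : ℂ) • opW u →
      g₁ - (Complex.I * ε) • g₂ - (Complex.I * ε * ((s ^ 2 : ℝ) : ℂ)⁻¹) •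
        (opS u 0 • ((s : ℂ) • dirac (unitIdx 0)))
      = -opT 0 ((ε * s : ℝ) : ℂ) ((ε / s : ℝ) : ℂ) u := by
    rintro u _ _ rfl rfl
    ext α
    have e1 : (opS u - u - (Complex.I * ε) • ((s : ℂ) • opW u)
        - (Complex.I * ε * ((s ^ 2 : ℝ) : ℂ)⁻¹) • (opS u 0 • ((s : ℂ) • dirac (unitIdx 0))) : Ell) α
        = opS u α - u α - (Complex.I * ε) * (s * opW u α)
          - (Complex.I * ε * ((s ^ 2 : ℝ) : ℂ)⁻¹) * (opS u 0 * (s * dirac (unitIdx 0) α)) := rfl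
    have e2 : (-opT 0 ((ε * s : ℝ) : ℂ) ((ε / s : ℝ) : ℂ) u : Ell) α
        = -(opT 0 ((ε * s : ℝ) : ℂ) ((ε / s : ℝ) : ℂ) u α) := rfl
    rw [e1, e2, opT_apply, hS, opW_apply, opS_apply_zero, dirac_apply, opS_apply]
    have := hdeg α
    push_cast
    split_ifs <;> field_simp <;> ring
  rw [mem_domain_opB_iff, hn]
  constructor
  · rintro ⟨g₁, g₂, h1, h2, rfl⟩
    rw [mem_graphL_iff b] at h1
    rw [mem_graphMul_iff b] at h2
    -- This is `(1 - L) f` in coefficients.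
    set u : Ell := coef b f - coef b g₁ with hu
    have hfu : coef b f = opS u := by
      ext α
      have : u α = coef b f α - coef b g₁ α := rfl
      rw [opS_apply, this, h1]
      have := hdeg α
      push_cast
      field_simp
      ring
    refine ⟨u, hfu, ?_⟩
    rw [map_sub, map_sub, map_smul, map_smul, map_smul, vSqrtM_smul, map_smul, coef_vSqrtM,
      inner_sqrtM b, hfu]
    refine hfin u _ _ ?_ ?_
    · rw [← hfu, hu]; abel
    · ext α
      have : ((s : ℂ) • opW u : Ell) α = s * opW u α := rfl
      rw [h2, this, opW_apply, hfu, opS_apply_sub, opS_apply_add, add_comm]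
  -- Since `opW` is bounded, `opS u` automatically lies in the domain of multiplication: the domain
  -- of `opB` is that of `L`.
  · rintro ⟨u, hfu, hg⟩
    refine ⟨(coef b).symm (opS u - u), (coef b).symm ((s : ℂ) • opW u), ?_, ?_, ?_⟩
    · rw [mem_graphL_iff b]
      intro α
      rw [LinearIsometryEquiv.apply_symm_apply, hfu]
      exact hS u α
    · rw [mem_graphMul_iff b]
      intro α
      rw [LinearIsometryEquiv.apply_symm_apply, hfu, opS_apply_sub, opS_apply_add]
      have : ((s : ℂ) • opW u : Ell) α = s * opW u α := rfl
      rw [this, opW_apply, add_comm]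
    · refine (coef b).injective ?_
      rw [hg, map_sub, map_sub, map_smul, LinearIsometryEquiv.apply_symm_apply,
        LinearIsometryEquiv.apply_symm_apply, map_smul, map_smul, vSqrtM_smul, map_smul,
        coef_vSqrtM, inner_sqrtM b, hfu]
      exact (hfin u _ _ rfl rfl).symm

/-! ### Resolvent set and eigenvectors of `opB` -/

lemma mem_resolventSet_opB {ε s : ℝ} (hs : 0 < s) {z : ℂ}
    (hT : Function.Bijective (opT z ((ε * s : ℝ) : ℂ) ((ε / s : ℝ) : ℂ))) :
    z ∈ resolventSet (opB ε (s • b 0)) := by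
  let T := opT z ((ε * s : ℝ) : ℂ) ((ε / s : ℝ) : ℂ)
  let e : Ell ≃L[ℂ] Ell := ContinuousLinearEquiv.ofBijective T
    (LinearMap.ker_eq_bot.2 hT.1) (LinearMap.range_eq_top.2 hT.2)
  have he : ∀ u, e u = T u := fun u => rfl
  refine ⟨((coef b).symm.toContinuousLinearEquiv : Ell →L[ℂ] L2) ∘L opS ∘L
    (e.symm : Ell →L[ℂ] Ell) ∘L ((coef b).toContinuousLinearEquiv : L2 →L[ℂ] Ell), ?_, ?_⟩
  · intro g
    set u := e.symm (coef b g) with hu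
    have hTu : T u = coef b g := by rw [← he, hu, ContinuousLinearEquiv.apply_symm_apply]
    obtain ⟨h, h'⟩ := (opB_iff b hs ((coef b).symm (opS u))
      ((coef b).symm (-opT 0 ((ε * s : ℝ) : ℂ) ((ε / s : ℝ) : ℂ) u))).2
      ⟨u, by rw [LinearIsometryEquiv.apply_symm_apply], by
        rw [LinearIsometryEquiv.apply_symm_apply]⟩
    refine ⟨h, ?_⟩
    change z • (coef b).symm (opS u) - opB ε (s • b 0) ⟨(coef b).symm (opS u), h⟩ = g
    rw [h']
    refine (coef b).injective ?_
    rw [map_sub, map_smul, LinearIsometryEquiv.apply_symm_apply,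
      LinearIsometryEquiv.apply_symm_apply, sub_neg_eq_add, ← opT_eq_add]
    exact hTu
  · intro f
    obtain ⟨u, hu, hu'⟩ := (opB_iff b hs (f : L2) (opB ε (s • b 0) f)).1 ⟨f.2, rfl⟩
    have h1 : coef b (z • (f : L2) - opB ε (s • b 0) f) = e u := by
      rw [map_sub, map_smul, hu, hu', sub_neg_eq_add, ← opT_eq_add]
      rfl
    change (coef b).symm (opS (e.symm (coef b (z • (f : L2) - opB ε (s • b 0) f)))) = f
    rw [h1, ContinuousLinearEquiv.symm_apply_apply, ← hu, LinearIsometryEquiv.symm_apply_apply]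

/-- Eigenvectors of `opB` correspond to the kernel of `opT` through `opS`. -/
lemma eigen_opB_iff {ε s : ℝ} (hs : 0 < s) (z : ℂ) (f : L2) :
    (∃ h : f ∈ (opB ε (s • b 0)).domain, opB ε (s • b 0) ⟨f, h⟩ = z • f) ↔
      ∃ u : Ell, coef b f = opS u ∧ opT z ((ε * s : ℝ) : ℂ) ((ε / s : ℝ) : ℂ) u = 0 := by
  rw [opB_iff b hs]
  refine exists_congr fun u => and_congr_right fun hu => ?_
  rw [map_smul, hu, opT_eq_add z, eq_neg_iff_add_eq_zero]

lemma mem_spectrum_of_eigen {E : Type*} [NormedAddCommGroup E] [NormedSpace ℂ E]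
    {T : E →ₗ.[ℂ] E} {z : ℂ} {f : E} (hf : f ≠ 0) (h : f ∈ T.domain) (hT : T ⟨f, h⟩ = z • f) :
    z ∈ spectrum T := by
  rintro ⟨R, -, hR⟩
  have := hR ⟨f, h⟩
  rw [hT, sub_self, map_zero] at this
  exact hf this.symm

/-- Choosing the square root with nonnegative real part keeps `κ + 1` away from zero, and `(κ - 1)(κ
+ 1)(1 - w) = w` bounds `κ - 1`. -/
lemma exists_sq_mul_one_sub_eq_one {w : ℂ} (hw : ‖w‖ ≤ 1 / 2) :
    ∃ κ : ℂ, κ ^ 2 * (1 - w) = 1 ∧ ‖κ - 1‖ ≤ 2 * ‖w‖ := by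
  have hn : 1 / 2 ≤ ‖1 - w‖ := by
    have := norm_sub_norm_le (1 : ℂ) w
    rw [norm_one] at this
    linarith
  have h0 : 1 - w ≠ 0 := norm_pos_iff.1 (by linarith)
  obtain ⟨k, hk⟩ := IsSquare.exists_sq ((1 - w)⁻¹) (IsAlgClosed.exists_eq_mul_self _)
  obtain ⟨κ, hκ, hre⟩ : ∃ κ : ℂ, (1 - w)⁻¹ = κ ^ 2 ∧ 0 ≤ κ.re := by
    rcases le_total 0 k.re with h | h
    · exact ⟨k, hk, h⟩
    · exact ⟨-k, by rw [neg_sq, hk], by simpa using h⟩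
  have h1 : κ ^ 2 * (1 - w) = 1 := by rw [← hκ, inv_mul_cancel₀ h0]
  refine ⟨κ, h1, ?_⟩
  have h2 : (κ - 1) * ((κ + 1) * (1 - w)) = w := by linear_combination h1
  have h3 : 1 ≤ ‖κ + 1‖ := by
    refine le_trans ?_ (Complex.re_le_norm _)
    simpa using hre
  have h4 : ‖κ - 1‖ * (1 * (1 / 2)) ≤ ‖w‖ := by
    calc ‖κ - 1‖ * (1 * (1 / 2)) ≤ ‖κ - 1‖ * (‖κ + 1‖ * ‖1 - w‖) := by gcongr
      _ = ‖w‖ := by rw [← norm_mul, ← norm_mul, h2]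
  linarith

lemma star_dirac (α : Idx) : star (dirac α) = dirac α := by
  ext β
  rw [lp.star_apply, dirac_apply]
  split_ifs <;> simp

lemma inner_dirac (α : Idx) (u : Ell) : inner ℂ (dirac α) u = u α := by
  rw [dirac, lp.inner_single_left]
  simp

/-- The inner product of `L²_ξ` in Hermite coefficients. -/
lemma innerXi_star (ξ : V3) (f : L2) :
    innerXi ξ f (star f) = inner ℂ (star (coef b f)) (coef b f)
      + ((‖ξ‖ ^ 2 : ℝ) : ℂ)⁻¹ * coef b f 0 ^ 2 := by
  have h : coef b (star f) = star (coef b f) := by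
    ext α
    rw [coef_star, lp.star_apply]
  rw [innerXi, ← (coef b).inner_map_map (star f), ← (coef b).inner_map_map (P0 (star f)), h,
    coef_P0, coef_P0, h, inner_smul_left, inner_smul_right, inner_dirac, dirac_apply, if_pos rfl,
    lp.star_apply, Complex.star_def, Complex.conj_conj]
  ring

/-- The conjugate in the first slot makes the form bilinear, so squares of `m` and `k` appear
instead of squared moduli. -/
lemma inner_star_self_smul (m k : ℂ) (y : Ell) (hy : y 0 = 0) :
    inner ℂ (star (m • (dirac 0 - k • y))) (m • (dirac 0 - k • y))
      = m ^ 2 * (1 + k ^ 2 * inner ℂ (star y) y) := by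
  have h1 : inner ℂ (star y) (dirac 0) = 0 := by
    rw [← inner_conj_symm, inner_dirac, lp.star_apply, hy]
    simp
  rw [star_smul, star_sub, star_smul, star_dirac, inner_smul_left, inner_smul_right,
    inner_sub_left, inner_sub_right, inner_sub_right, inner_smul_left, inner_smul_left,
    inner_smul_right, inner_smul_right, inner_dirac, inner_dirac, h1, hy, dirac_apply, if_pos rfl]
  simp only [Complex.star_def, Complex.conj_conj]
  ring

set_option maxHeartbeats 1000000 in
/-- The normalized eigenfunction in Hermite coefficients. -/
lemma exists_eigenfunction {ε s : ℝ} (hs : 0 < s) (hε : 0 < ε) {z : ℂ} (hz : -(1 / 2) ≤ z.re)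
    (ha : ε * s ≤ 1 / 16) (hμ : ε ^ 2 * (1 + s ^ 2) ≤ 1 / 256)
    (hd : z + ((ε ^ 2 * (1 + s ^ 2) : ℝ) : ℂ) * dispR z ((ε * s : ℝ) : ℂ) = 0) :
    ∃ ψ : L2, ψ ≠ 0 ∧
      (∃ h : ψ ∈ (opB ε (s • b 0)).domain, opB ε (s • b 0) ⟨ψ, h⟩ = z • ψ) ∧
      innerXi (s • b 0) ψ (star ψ) = 1 ∧
      (∀ f : (opB ε (s • b 0)).domain, opB ε (s • b 0) f = z • (f : L2) →
        ∃ c : ℂ, (f : L2) = c • ψ) ∧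
      ‖P0 ψ - ((s / Real.sqrt (1 + s ^ 2) : ℝ) : ℂ) • sqrtM‖ ≤ 1200 * (ε * s) ∧
      ‖P1 ψ - (-Complex.I * ((ε * Real.sqrt (1 + s ^ 2) : ℝ) : ℂ)) • vSqrtM (b 0)‖
        ≤ 1200 * (ε ^ 2 * (1 + s ^ 2)) := by
  set S : ℝ := Real.sqrt (1 + s ^ 2) with hS
  have hS2 : S ^ 2 = 1 + s ^ 2 := Real.sq_sqrt (by positivity)
  have hSpos : 0 < S := Real.sqrt_pos.2 (by positivity)
  have hsC : (s : ℂ) ≠ 0 := Complex.ofReal_ne_zero.2 hs.ne'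
  have hSC : (S : ℂ) ≠ 0 := Complex.ofReal_ne_zero.2 hSpos.ne'
  have hS2C : (S : ℂ) ^ 2 = 1 + (s : ℂ) ^ 2 := by exact_mod_cast congrArg Complex.ofReal hS2
  have hn : ‖s • b 0‖ = s := by
    rw [norm_smul, b.norm_eq_one, Real.norm_of_nonneg hs.le, mul_one]
  set a : ℂ := ((ε * s : ℝ) : ℂ) with ha'
  set c : ℂ := ((ε / s : ℝ) : ℂ) with hc'
  have han : ‖a‖ = ε * s := by rw [ha', Complex.norm_real, Real.norm_of_nonneg (by positivity)]
  have ha1 : ‖a‖ ≤ 1 / 16 := by rw [han]; exact ha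
  have hac : a + c = ε * S ^ 2 / s := by
    rw [ha', hc', hS2C]
    push_cast
    field_simp
    ring
  have haac : a * (a + c) = ((ε ^ 2 * (1 + s ^ 2) : ℝ) : ℂ) := by
    rw [hac, hS2C, ha']
    push_cast
    field_simp
  rw [← haac] at hd
  set p : Ell := vecP z a with hp
  set y : Ell := opS p with hy
  have hp0 : p 0 = 0 := vecP_apply_zero hz ha1
  have hy0 : y 0 = 0 := by rw [hy, opS_apply_zero, hp0]
  have hyn : ‖y‖ ≤ 8 := (norm_opS_apply_le p).trans (norm_vecP_le hz ha1)
  set q : ℂ := inner ℂ (star y) y with hq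
  have hqn : ‖q‖ ≤ 64 := by
    calc ‖q‖ ≤ ‖star y‖ * ‖y‖ := norm_inner_le_norm _ _
      _ ≤ 8 * 8 := by rw [norm_star]; gcongr
      _ = 64 := by norm_num
  set μ : ℝ := ε ^ 2 * (1 + s ^ 2) with hμ'
  have hμ0 : 0 < μ := by positivity
  have hwn : ‖(μ : ℂ) * q‖ ≤ 64 * μ := by
    rw [norm_mul, Complex.norm_real, Real.norm_of_nonneg hμ0.le, mul_comm]
    gcongr
  -- With `1 + s⁻² = S²/s²` and `(a+c)² = ε²S⁴/s²`, the normalization reads `m² (S²/s²)(1 - μq) =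
  -- 1`; so `m = κ s/S`. Here `‖μq‖ ≤ 64/256 = 1/4`.
  obtain ⟨κ, hκ, hκ1⟩ := exists_sq_mul_one_sub_eq_one (w := μ * q) (by linarith)
  have hκn : ‖κ - 1‖ ≤ 128 * μ := by linarith
  set t : ℝ := ε * S with ht
  have ht0 : 0 < t := by positivity
  have ht2 : t ^ 2 = μ := by rw [ht, mul_pow, hS2]
  have ht1 : t ≤ 1 / 16 := by nlinarith
  set m : ℂ := κ * (s / S) with hm
  set A : ℂ := Complex.I * (a + c) with hA
  set ψ : L2 := (coef b).symm (m • (dirac 0 - A • y)) with hψ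
  have hcψ : coef b ψ = m • (dirac 0 - A • y) := by rw [hψ, LinearIsometryEquiv.apply_symm_apply]
  have hcψ0 : coef b ψ 0 = m := by
    rw [hcψ]
    change m * (dirac 0 0 - A * y 0) = m
    rw [dirac_apply, if_pos rfl, hy0]
    ring
  have hκ0 : κ ≠ 0 := by
    rintro rfl
    simp at hκ
  have hm0 : m ≠ 0 := mul_ne_zero hκ0 (div_ne_zero hsC hSC)
  have hS0 : opS (dirac 0) = dirac 0 := by
    rw [opS_dirac, deg_zero]
    simp
  refine ⟨ψ, ?_, ?_, ?_, ?_, ?_, ?_⟩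
  · intro h
    rw [h, map_zero] at hcψ0
    exact hm0 hcψ0.symm
  · refine (eigen_opB_iff b hs z ψ).2 ⟨m • (dirac 0 - A • p), ?_, ?_⟩
    · rw [hcψ, map_smul, map_sub, map_smul, hS0]
    · rw [map_smul, (opT_eq_zero_iff hz ha1 _).2, smul_zero]
      have : (dirac 0 - A • p : Ell) 0 = 1 := by
        change dirac 0 0 - A * p 0 = 1
        rw [dirac_apply, if_pos rfl, hp0]
        ring
      rw [this, hd, zero_mul, one_smul, mul_one]
      exact ⟨rfl, rfl⟩
  · have hA2 : A ^ 2 = -(ε * S ^ 2 / s) ^ 2 := by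
      rw [hA, hac, mul_pow, Complex.I_sq]; ring
    rw [innerXi_star b, hcψ0, hcψ, inner_star_self_smul _ _ _ hy0, hn, ← hq, hA2, hm]
    have h1 : ((μ : ℝ) : ℂ) = ε ^ 2 * S ^ 2 := by
      rw [hμ', hS2C]; push_cast; ring
    rw [h1] at hκ
    have h2 : κ ^ 2 * ε ^ 2 * S ^ 2 * q = κ ^ 2 - 1 := by linear_combination -hκ
    push_cast
    field_simp
    have h3 : (s : ℂ) ^ 2 = S ^ 2 - 1 := by rw [hS2C]; ring
    linear_combination κ ^ 2 * h3 - S ^ 2 * h2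
  · intro f hf
    obtain ⟨u, hu, hTu⟩ := (eigen_opB_iff b hs z (f : L2)).1 ⟨f.2, hf⟩
    obtain ⟨-, hu2⟩ := (opT_eq_zero_iff hz ha1 u).1 hTu
    refine ⟨u 0 * m⁻¹, (coef b).injective ?_⟩
    have hu3 : u = u 0 • (dirac 0 - A • p) := by
      nth_rw 1 [hu2]
      rw [smul_sub, smul_smul, hA, mul_comm (u 0)]
    rw [map_smul, hcψ, smul_smul, inv_mul_cancel_right₀ hm0, hu]
    nth_rw 1 [hu3]
    rw [map_smul, map_sub, map_smul, hS0]
  · have h1 : coef b (P0 ψ - ((s / S : ℝ) : ℂ) • sqrtM) = ((κ - 1) * (s / S)) • dirac 0 := by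
      rw [map_sub, map_smul, coef_P0, coef_sqrtM, hcψ0, hm, ← sub_smul]
      congr 1
      push_cast
      ring
    have h2 : ‖(s / S : ℂ)‖ = s / S := by
      rw [← Complex.ofReal_div, Complex.norm_real, Real.norm_of_nonneg (by positivity)]
    rw [← (coef b).norm_map, h1, norm_smul, norm_dirac, mul_one, norm_mul, h2]
    -- Half of the smallness of `μ = t²` cancels `S` and leaves the factor `ε s`, so the bound is
    -- also small as `s → 0`.
    have h3 : μ * (s / S) = t * (ε * s) := by
      rw [← ht2, ht]
      field_simp
    calc ‖κ - 1‖ * (s / S) ≤ 128 * μ * (s / S) := by gcongr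
      _ = 128 * (t * (ε * s)) := by rw [mul_assoc, h3]
      _ ≤ 128 * (1 * (ε * s)) := by
          gcongr
          linarith
      _ ≤ 1200 * (ε * s) := by nlinarith [mul_pos hε hs]
  · have h1 : coef b (P1 ψ - (-Complex.I * ((t : ℝ) : ℂ)) • vSqrtM (b 0))
        = (-Complex.I * t) • ((κ - 1) • y + (y - dirac (unitIdx 0))) := by
      rw [map_sub, map_smul, coef_P1, coef_vSqrtM, hcψ0, hcψ]
      -- The singular factor `1/s` of `A` cancels against `m`, leaving an amplitude of size `t = ε
      -- S`.
      have h2 : m * A = Complex.I * t * κ := by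
        rw [hm, hA, hac, ht]
        push_cast
        field_simp
      rw [smul_sub, smul_smul, h2]
      module
    have h2 := norm_dispersion_root_le hz ha1 hd
    have h3 := norm_opS_vecP_sub_le hz ha1
    rw [haac, Complex.norm_real, Real.norm_of_nonneg hμ0.le] at h2
    have h4 : ε * s ≤ t := by
      rw [ht]
      gcongr
      exact Real.le_sqrt_of_sq_le (by linarith)
    have h5 : μ ≤ t := by rw [← ht2]; nlinarith
    rw [← (coef b).norm_map, h1, norm_smul, norm_mul, norm_neg, Complex.norm_I, one_mul,
      Complex.norm_real, Real.norm_of_nonneg ht0.le]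
    -- As `μ ≤ t` and `ε s ≤ t`, the total is at most `(128·8 + 32·4 + 32) t = 1184 t`.
    have h6 : ‖(κ - 1) • y + (y - dirac (unitIdx 0))‖ ≤ 1200 * t := by
      refine (norm_add_le _ _).trans ?_
      rw [norm_smul]
      calc ‖κ - 1‖ * ‖y‖ + ‖y - dirac (unitIdx 0)‖
          ≤ 128 * μ * 8 + 32 * (4 * μ + ε * s) := by
            refine add_le_add (by gcongr) (h3.trans ?_)
            rw [han]
            gcongr
        _ ≤ 1200 * t := by nlinarith
    refine (mul_le_mul_of_nonneg_left h6 ht0.le).trans (le_of_eq ?_)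
    rw [← ht2]
    ring

lemma exists_basis_of_ne_zero {ξ : V3} (hξ : ξ ≠ 0) :
    ∃ b : OrthonormalBasis (Fin 3) ℝ V3, b 0 = ‖ξ‖⁻¹ • ξ := by
  have hv : Orthonormal ℝ (({0} : Set (Fin 3)).domRestrict fun _ => ‖ξ‖⁻¹ • ξ) := by
    refine ⟨fun i => ?_, fun i j hij => (hij (Subsingleton.elim i j)).elim⟩
    change ‖‖ξ‖⁻¹ • ξ‖ = 1
    rw [norm_smul, norm_inv, norm_norm, inv_mul_cancel₀ (norm_ne_zero_iff.2 hξ)]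
  obtain ⟨b, hb⟩ := hv.exists_orthonormalBasis_extension_of_card_eq (by simp)
  exact ⟨b, hb 0 rfl⟩

end

end VPFP

/-! ### Assembly of the theorem -/

open VPFP in
theorem theorem2p1 :
    ∃ r₀ : ℝ, 0 < r₀ ∧ ∃ C : ℝ, 0 < C ∧
    ∃ lam₀ : ℝ → ℝ → ℂ, ∃ ψ₀ : VPFP.V3 → ℝ → VPFP.L2,
      -- the eigenvalue is a smooth function of `s = |ξ|` and `ε`, with its expansion
      ContDiffOn ℝ ∞ (fun p : ℝ × ℝ => lam₀ p.1 p.2) {p : ℝ × ℝ | |p.2| * (1 + |p.1|) ≤ r₀} ∧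
      (∀ s ε : ℝ, |ε| * (1 + |s|) ≤ r₀ →
        ‖lam₀ s ε - ((-(ε ^ 2 * (1 + s ^ 2)) : ℝ) : ℂ)‖ ≤ C * (ε ^ 4 * (1 + s ^ 2) ^ 2)) ∧
      ∀ (ξ : VPFP.V3) (ε : ℝ), ξ ≠ 0 → 0 < ε → ε * (1 + ‖ξ‖) ≤ r₀ →
        -- the spectrum in the half-plane is one point
        VPFP.spectrum (VPFP.opB ε ξ) ∩ {z : ℂ | -(1 / 2 : ℝ) < z.re} = {lam₀ ‖ξ‖ ε} ∧
        -- it is an eigenvalue with normalized eigenfunction `ψ₀`, unique up to a scalar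
        (∃ h : ψ₀ ξ ε ∈ (VPFP.opB ε ξ).domain,
          VPFP.opB ε ξ ⟨ψ₀ ξ ε, h⟩ = lam₀ ‖ξ‖ ε • ψ₀ ξ ε) ∧
        VPFP.innerXi ξ (ψ₀ ξ ε) (star (ψ₀ ξ ε)) = 1 ∧
        (∀ f : (VPFP.opB ε ξ).domain, VPFP.opB ε ξ f = lam₀ ‖ξ‖ ε • (f : VPFP.L2) →
          ∃ c : ℂ, (f : VPFP.L2) = c • ψ₀ ξ ε) ∧
        -- the macroscopic and the microscopic part of the eigenfunction
        ‖VPFP.P0 (ψ₀ ξ ε) - ((‖ξ‖ / Real.sqrt (1 + ‖ξ‖ ^ 2) : ℝ) : ℂ) • VPFP.sqrtM‖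
          ≤ C * (ε * ‖ξ‖) ∧
        ‖VPFP.P1 (ψ₀ ξ ε) - (-Complex.I * ((ε * Real.sqrt (1 + ‖ξ‖ ^ 2) : ℝ) : ℂ)) •
            VPFP.vSqrtM (‖ξ‖⁻¹ • ξ)‖
          ≤ C * (ε ^ 2 * (1 + ‖ξ‖ ^ 2)) := by
  obtain ⟨r₀, hr0, hr1, lam, hsmooth, hlam⟩ := exists_eigenvalue_branch
  have key : ∀ (ξ : V3) (ε : ℝ), ∃ ψ : L2, ξ ≠ 0 → 0 < ε → ε * (1 + ‖ξ‖) ≤ r₀ →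
      VPFP.spectrum (opB ε ξ) ∩ {z : ℂ | -(1 / 2 : ℝ) < z.re} = {lam ‖ξ‖ ε} ∧
      (∃ h : ψ ∈ (opB ε ξ).domain, opB ε ξ ⟨ψ, h⟩ = lam ‖ξ‖ ε • ψ) ∧
      innerXi ξ ψ (star ψ) = 1 ∧
      (∀ f : (opB ε ξ).domain, opB ε ξ f = lam ‖ξ‖ ε • (f : L2) → ∃ c : ℂ, (f : L2) = c • ψ) ∧
      ‖P0 ψ - ((‖ξ‖ / Real.sqrt (1 + ‖ξ‖ ^ 2) : ℝ) : ℂ) • sqrtM‖ ≤ 1200 * (ε * ‖ξ‖) ∧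
      ‖P1 ψ - (-Complex.I * ((ε * Real.sqrt (1 + ‖ξ‖ ^ 2) : ℝ) : ℂ)) • vSqrtM (‖ξ‖⁻¹ • ξ)‖
        ≤ 1200 * (ε ^ 2 * (1 + ‖ξ‖ ^ 2)) := by
    intro ξ ε
    by_cases h : ξ ≠ 0 ∧ 0 < ε ∧ ε * (1 + ‖ξ‖) ≤ r₀
    swap
    -- Outside the admissible range the eigenfunction is given the value `0`.
    · exact ⟨0, fun h1 h2 h3 => (h ⟨h1, h2, h3⟩).elim⟩
    obtain ⟨hξ, hε, hr⟩ := h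
    obtain ⟨b, hb⟩ := exists_basis_of_ne_zero hξ
    set s : ℝ := ‖ξ‖ with hs'
    have hs : 0 < s := norm_pos_iff.2 hξ
    have hξb : ξ = s • b 0 := by rw [hb, smul_smul, mul_inv_cancel₀ hs.ne', one_smul]
    have hr' : |ε| * (1 + |s|) ≤ r₀ := by rwa [abs_of_pos hε, abs_of_pos hs]
    obtain ⟨h1, -, h3⟩ := abs_sq_mul_le hr0.le hr1 hr'
    have ha : ε * s ≤ 1 / 16 := (le_abs_self _).trans (h1.trans hr1)
    have haC : ‖((ε * s : ℝ) : ℂ)‖ ≤ 1 / 16 := by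
      rw [Complex.norm_real]; exact h1.trans hr1
    obtain ⟨hre, hroot⟩ := hlam s ε hr'
    obtain ⟨ψ, hψ0, hψ1, hψ2, hψ3, hψ4, hψ5⟩ :=
      exists_eigenfunction b hs hε hre.le ha h3 hroot
    refine ⟨ψ, fun _ _ _ => ?_⟩
    rw [← hb]
    refine ⟨?_, hξb ▸ hψ1, hξb ▸ hψ2, hξb ▸ hψ3, hψ4, hψ5⟩
    rw [hξb]
    ext z
    simp only [Set.mem_inter_iff, Set.mem_ofPred_eq, Set.mem_singleton_iff]
    constructor
    · rintro ⟨hz1, hz2⟩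
      -- A point of the half-plane other than the branch violates the dispersion relation, so `opT`
      -- is bijective there and the point lies in the resolvent set.
      by_contra hne
      refine hz1 (mem_resolventSet_opB b hs (opT_bijective hz2.le haC fun h0 => hne ?_))
      have hac : ((ε * s : ℝ) : ℂ) * (((ε * s : ℝ) : ℂ) + ((ε / s : ℝ) : ℂ))
          = ((ε ^ 2 * (1 + s ^ 2) : ℝ) : ℂ) := by
        rw [← Complex.ofReal_add, ← Complex.ofReal_mul]
        congr 1
        field_simp
        ring
      rw [hac] at h0
      refine dispersion_root_unique hz2.le hre.le haC ?_ h0 hroot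
      rw [Complex.norm_real, Real.norm_of_nonneg (by positivity)]
      linarith
    · rintro rfl
      obtain ⟨hd, he⟩ := hψ1
      exact ⟨mem_spectrum_of_eigen hψ0 hd he, hre⟩
  choose ψ₀ hψ₀ using key
  refine ⟨r₀, hr0, 1200, by norm_num, lam, ψ₀, hsmooth, fun s ε h => ?_, hψ₀⟩
  obtain ⟨h1, -, h3⟩ := abs_sq_mul_le hr0.le hr1 h
  obtain ⟨hre, hroot⟩ := hlam s ε h
  have h4 := norm_dispersion_root_add_le hre.le (by
    rw [Complex.norm_real]; exact h1.trans hr1) hroot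
  rw [Complex.norm_real, Complex.norm_real, Real.norm_eq_abs, Real.norm_eq_abs, sq_abs,
    abs_of_nonneg (by positivity)] at h4
  have h5 : lam s ε - ((-(ε ^ 2 * (1 + s ^ 2)) : ℝ) : ℂ)
      = lam s ε + ((ε ^ 2 * (1 + s ^ 2) : ℝ) : ℂ) := by
    push_cast; ring
  rw [h5]
  refine h4.trans ?_
  -- As `a² ≤ μ`, the error `256 μ (μ + a²)` is at most `512 μ²`.
  have h6 : (ε * s) ^ 2 ≤ ε ^ 2 * (1 + s ^ 2) := by nlinarith [sq_nonneg ε]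
  have h7 : 0 ≤ ε ^ 2 * (1 + s ^ 2) := by positivity
  calc 256 * (ε ^ 2 * (1 + s ^ 2)) * (ε ^ 2 * (1 + s ^ 2) + (ε * s) ^ 2)
      ≤ 256 * (ε ^ 2 * (1 + s ^ 2)) * (ε ^ 2 * (1 + s ^ 2) + ε ^ 2 * (1 + s ^ 2)) := by gcongr
    _ = 512 * (ε ^ 2 * (1 + s ^ 2)) ^ 2 := by ring
    _ ≤ 1200 * (ε ^ 2 * (1 + s ^ 2)) ^ 2 := by gcongr; norm_num
    _ = 1200 * (ε ^ 4 * (1 + s ^ 2) ^ 2) := by ring
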